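/- For $\mathcal A\in\mathbb R^{n_1\times n_2\times n_3}$ let $\|\mathcal A\|_F$ be the Frobenius norm, $\|\mathcal A\|_1$ the sum of the absolute values of the entries, and $\|\mathcal A\|_*=\frac1{n_3}\sum_{i=1}^{n_3}\sum_{j=1}^{\min(n_1,n_2)}\sigma_{ij}$ the tensor nuclear norm, where $\sigma_{ij}$ is the $j$-th singular value of the $i$-th frontal slice of the discrete Fourier transform of $\mathcal A$ along the third dimension. Let $\mathcal X\in\mathbb R^{n_1\times n_2\times n_3}$, $\lambda>0$, $\mu_1,\mu_2,\mu_3>0$, and for $\mathcal H\ne\mathcal O$, $\mathcal D\neq\mathcal O$ let $$L_2(\mathcal L,\mathcal H,\mathcal E,\mathcal D,\mathcal Y,\mathcal Z,\mathcal U)=\frac{\|\mathcal L\|_*}{\|\mathcal H\|_F}+\lambda\frac{\|\mathcal E\|_1}{\|\mathcal D\|_F}+\frac{\mu_1}2\|\mathcal L-\mathcal H\|_F^2+\langle\mathcal Y,\mathcal L-\mathcal H\rangle+\frac{\mu_2}2\|\mathcal L+\mathcal E-\mathcal X\|_F^2+\langle\mathcal Z,\mathcal L+\mathcal E-\mathcal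 X\rangle+\frac{\mu_3}2\|\mathcal E-\mathcal D\|_F^2+\langle\mathcal U,\mathcal E-\mathcal D\rangle$$ be the augmented Lagrangian of the TNF+ model ($L_2=+\infty$ if $\mathcal H=\mathcal O$ or $\mathcal D=\mathcal O$). Let $\mathcal C^{(k)}=(\mathcal L^{(k)},\mathcal H^{(k)},\mathcal E^{(k)},\mathcal D^{(k)},\mathcal Y^{(k)},\mathcal Z^{(k)},\mathcal U^{(k)})$, $k\ge0$, be generated, from any starting point, by the ADMM scheme: $\mathcal L^{(k+1)}$, $\mathcal H^{(k+1)}$, $\mathcal E^{(k+1)}$, $\mathcal D^{(k+1)}$ are, in this order, global minimizers of $L_2$ in the respective variable (over $\mathcal H\ne\mathcal O$, resp. $\mathcal D\ne\mathcal O$, in the second and fourth case), the other variables being kept at their latest values, and then $$\mathcal Y^{(k+1)}=\mathcal Y^{(k)}+\mu_1(\mathcal L^{(k+1)}-\mathcal H^{(k+1)}),\quad \mathcal Z^{(k+1)}=\mathcal Z^{(k)}+\mu_2(\mathcal L^{(k+1)}+\mathcal E^{(k+1)}-\mathcal X),\quad \mathcal U^{(k+1)}=\mathcal U^{(k)}+\mu_3(\mathcal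 E^{(k+1)}-\mathcal D^{(k+1)}).$$ Assume, for constants $M,m$ and $\delta_1,\delta_2>0$: (A3) $\{\mathcal L^{(k)}\}$ and $\{\mathcal E^{(k)}\}$ are bounded, with $\|\mathcal L^{(k)}\|_*\le M$ and $\|\mathcal E^{(k)}\|_1\le m$ for all $k$; (A4) $\|\mathcal H^{(k)}\|_F\ge\delta_1$ and $\|\mathcal D^{(k)}\|_F\ge\delta_2$ for all $k$. Then: (i) the sequences $\{\mathcal L^{(k)}\},\{\mathcal H^{(k)}\},\{\mathcal E^{(k)}\},\{\mathcal D^{(k)}\},\{\mathcal Y^{(k)}\},\{\mathcal Z^{(k)}\},\{\mathcal U^{(k)}\}$ are bounded; (ii) $\{\mathcal C^{(k)}\}$ has a convergent subsequence, with a limit $\mathcal C^*$. If $\lim_{k\to\infty}\|\mathcal Z^{(k+1)}-\mathcal Z^{(k)}\|_F=0$ and $\mu_1,\mu_3$ are sufficiently large (at least a threshold that depends only on $n_1,n_2,n_3,\lambda,M,m,\delta_1,\delta_2$), then such a subsequence can be chosen so that $\mathcal C^*$ is a critical point of $L_2$, i.e. $\mathcal O\in\partial L_2(\mathcal C^*)$,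 where $\partial$ is the limiting (Mordukhovich) subdifferential in all seven variables jointly. -/

import Mathlib

noncomputable section

namespace TNFPlus

/-- Real third-order tensors of size `n₁ × n₂ × n₃`. The norm of this space is the Frobenius norm
and its inner product is the entrywise one. -/
abbrev Tensor (n₁ n₂ n₃ : ℕ) : Type := EuclideanSpace ℝ (Fin n₁ × Fin n₂ × Fin n₃)

/-- The `k`-th frontal slice of the discrete Fourier transform of `A` along the third dimension:
its `(i, j)` entry is `∑ l, A i j l * exp (- 2 π i k l / n₃)` (indices starting at `0`). -/
def fourierSlice {n₁ n₂ n₃ : ℕ} (A : Tensor n₁ n₂ n₃) (k : Fin n₃) :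
    Matrix (Fin n₁) (Fin n₂) ℂ :=
  Matrix.of fun i j => ∑ l : Fin n₃, (A (i, j, l) : ℂ) *
    Complex.exp (-(2 * (Real.pi : ℂ) * Complex.I * ((k : ℕ) : ℂ) * ((l : ℕ) : ℂ) / (n₃ : ℂ)))

/-- The nuclear norm of a complex matrix: the sum of its `min n₁ n₂` singular values. -/
def matrixNuclearNorm {n₁ n₂ : ℕ} (A : Matrix (Fin n₁) (Fin n₂) ℂ) : ℝ :=
  ∑ j ∈ Finset.range (min n₁ n₂), (Matrix.toEuclideanLin A).singularValues j

/-- The tensor nuclear norm: the average over the Fourier slices of their nuclear norms. -/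
def nuclearNorm {n₁ n₂ n₃ : ℕ} (A : Tensor n₁ n₂ n₃) : ℝ :=
  (1 / (n₃ : ℝ)) * ∑ k : Fin n₃, matrixNuclearNorm (fourierSlice A k)

/-- The `ℓ₁` norm of a tensor. -/
def l1Norm {n₁ n₂ n₃ : ℕ} (A : Tensor n₁ n₂ n₃) : ℝ := ∑ p, |A p|

/-- The augmented Lagrangian `L₂(L, H, E, D, Y, Z, U)` of the TNF+ model, with data `X`,
weight `lam` and penalty parameters `μ₁, μ₂, μ₃`. It is meaningful for `H ≠ 0` and `D ≠ 0`; every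
use below is restricted to such arguments. -/
def augLagrangian {n₁ n₂ n₃ : ℕ} (X : Tensor n₁ n₂ n₃) (lam μ₁ μ₂ μ₃ : ℝ)
    (L H E D Y Z U : Tensor n₁ n₂ n₃) : ℝ :=
  nuclearNorm L / ‖H‖ + lam * (l1Norm E / ‖D‖)
    + μ₁ / 2 * ‖L - H‖ ^ 2 + inner ℝ Y (L - H)
    + μ₂ / 2 * ‖L + E - X‖ ^ 2 + inner ℝ Z (L + E - X)
    + μ₃ / 2 * ‖E - D‖ ^ 2 + inner ℝ U (E - D)

/-- `x` is a minimizer of `f` over the set `s`. -/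
def IsArgminOn {V : Type*} (f : V → ℝ) (s : Set V) (x : V) : Prop := x ∈ s ∧ IsMinOn f s x

/-- The sequences are generated by the ADMM iteration of the TNF+ model (from any initial point).
Each `argmin` may be any global minimizer; the minimizations in `H` and `D` run over the nonzero
tensors, where the objective is defined. -/
structure IsADMMSequence {n₁ n₂ n₃ : ℕ} (X : Tensor n₁ n₂ n₃) (lam μ₁ μ₂ μ₃ : ℝ)
    (L H E D Y Z U : ℕ → Tensor n₁ n₂ n₃) : Prop where
  L_update : ∀ k, IsArgminOn
    (fun T => augLagrangian X lam μ₁ μ₂ μ₃ T (H k) (E k) (D k) (Y k) (Z k) (U k))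
    Set.univ (L (k + 1))
  H_update : ∀ k, IsArgminOn
    (fun T => augLagrangian X lam μ₁ μ₂ μ₃ (L (k + 1)) T (E k) (D k) (Y k) (Z k) (U k))
    {T | T ≠ 0} (H (k + 1))
  E_update : ∀ k, IsArgminOn
    (fun T => augLagrangian X lam μ₁ μ₂ μ₃ (L (k + 1)) (H (k + 1)) T (D k) (Y k) (Z k) (U k))
    Set.univ (E (k + 1))
  D_update : ∀ k, IsArgminOn
    (fun T => augLagrangian X lam μ₁ μ₂ μ₃ (L (k + 1)) (H (k + 1)) (E (k + 1)) T
      (Y k) (Z k) (U k))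
    {T | T ≠ 0} (D (k + 1))
  Y_update : ∀ k, Y (k + 1) = Y k + μ₁ • (L (k + 1) - H (k + 1))
  Z_update : ∀ k, Z (k + 1) = Z k + μ₂ • (L (k + 1) + E (k + 1) - X)
  U_update : ∀ k, U (k + 1) = U k + μ₃ • (E (k + 1) - D (k + 1))

/-- The sequences `L` and `E` are bounded, the nuclear norms of `L k` by `M` and the `ℓ₁` norms of
`E k` by `m`. -/
structure BoundedIterates {n₁ n₂ n₃ : ℕ} (L E : ℕ → Tensor n₁ n₂ n₃) (M m : ℝ) : Prop where
  L_bounded : Bornology.IsBounded (Set.range L)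
  E_bounded : Bornology.IsBounded (Set.range E)
  nuclearNorm_le : ∀ k, nuclearNorm (L k) ≤ M
  l1Norm_le : ∀ k, l1Norm (E k) ≤ m

/-- The Frobenius norms of `H k` and `D k` are bounded below by `δ₁` and `δ₂`. -/
structure DenominatorsBoundedBelow {n₁ n₂ n₃ : ℕ} (H D : ℕ → Tensor n₁ n₂ n₃) (δ₁ δ₂ : ℝ) :
    Prop where
  H_le : ∀ k, δ₁ ≤ ‖H k‖
  D_le : ∀ k, δ₂ ≤ ‖D k‖

/-- The Fréchet (regular) subdifferential at `x` of the function equal to `f` on `s` and to `+∞`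
off `s`. -/
def frechetSubdifferential {V : Type*} [NormedAddCommGroup V] [InnerProductSpace ℝ V]
    (f : V → ℝ) (s : Set V) (x : V) : Set V :=
  {v | x ∈ s ∧ ∀ ε > (0 : ℝ), ∀ᶠ y in nhdsWithin x s,
    f x + inner ℝ v (y - x) - ε * ‖y - x‖ ≤ f y}

/-- The limiting (Mordukhovich) subdifferential at `x` of the function equal to `f` on `s` and to
`+∞` off `s`. -/
def limitingSubdifferential {V : Type*} [NormedAddCommGroup V] [InnerProductSpace ℝ V]
    (f : V → ℝ) (s : Set V) (x : V) : Set V :=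
  {v | x ∈ s ∧ ∃ (xs : ℕ → V) (vs : ℕ → V),
    (∀ i, vs i ∈ frechetSubdifferential f s (xs i)) ∧
    Filter.Tendsto xs Filter.atTop (nhds x) ∧
    Filter.Tendsto (fun i => f (xs i)) Filter.atTop (nhds (f x)) ∧
    Filter.Tendsto vs Filter.atTop (nhds v)}

/-- Seven-tuples of tensors with the Euclidean product structure. -/
abbrev State (n₁ n₂ n₃ : ℕ) : Type := PiLp 2 (fun _ : Fin 7 => Tensor n₁ n₂ n₃)

/-- The tuple `(L, H, E, D, Y, Z, U)`. -/
def mkState {n₁ n₂ n₃ : ℕ} (L H E D Y Z U : Tensor n₁ n₂ n₃) : State n₁ n₂ n₃ :=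
  WithLp.toLp 2 ![L, H, E, D, Y, Z, U]

/-- The augmented Lagrangian as a function of the tuple of all seven variables. -/
def stateLagrangian {n₁ n₂ n₃ : ℕ} (X : Tensor n₁ n₂ n₃) (lam μ₁ μ₂ μ₃ : ℝ)
    (C : State n₁ n₂ n₃) : ℝ :=
  augLagrangian X lam μ₁ μ₂ μ₃ (C 0) (C 1) (C 2) (C 3) (C 4) (C 5) (C 6)

/-- The domain of the augmented Lagrangian: `H ≠ 0` and `D ≠ 0`. -/
def stateDomain (n₁ n₂ n₃ : ℕ) : Set (State n₁ n₂ n₃) := {C | C 1 ≠ 0 ∧ C 3 ≠ 0}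

/-- `C` is a critical point of the augmented Lagrangian: zero lies in its limiting
subdifferential, taken in all seven variables jointly. -/
def IsCriticalPoint {n₁ n₂ n₃ : ℕ} (X : Tensor n₁ n₂ n₃) (lam μ₁ μ₂ μ₃ : ℝ)
    (C : State n₁ n₂ n₃) : Prop :=
  (0 : State n₁ n₂ n₃) ∈
    limitingSubdifferential (stateLagrangian X lam μ₁ μ₂ μ₃) (stateDomain n₁ n₂ n₃) C

end TNFPlus

end

/-!
The Lagrangian splits into two blocks of the same shape, a seminorm divided by a norm plus a penalty
term, in the variables `(L, H, Y)` and `(E, D, U)`, coupled only by the constraint `L + E = X`. The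
numerators are the tensor nuclear norm and a multiple of the `ℓ₁` norm. That the nuclear norm is a
seminorm follows from its variational description: the sum of the singular values of `T` is the
largest value of `∑ j, ⟪u j, T (v j)⟫` over finite orthonormal families `u` and `v`
(`norm_sum_inner_le_sum_singularValues`, `exists_orthonormal_sum_inner_eq_sum_singularValues`).

Boundedness: stationarity in `H` together with the update of `Y` gives `Y = -(p L / ‖H‖ ^ 3) • H`
(`one_div_norm_stationary`), which is bounded because the numerator is bounded and the denominator
is bounded away from zero; the same holds for `U`. The multiplier updates then bound `H` and `D`,
and the optimality of `E` bounds `Z`.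

Decrease: the steps in `L` and `E` minimize strongly convex functions. The function `1 / ‖·‖` is
weakly convex, with a modulus depending only on the base point (`one_div_norm_ge`), so that the
steps in `H` and `D` also decrease the Lagrangian quadratically for large penalty parameters. The
formula for the multipliers makes their steps Lipschitz in the primal steps, whence the increase
caused by the updates of `Y` and `U` is absorbed (`half_sq_le_block_decrease`). What remains is the
increase `‖Z (k + 1) - Z k‖ ^ 2 / μ₂`, which tends to zero by assumption but need not be summable.
As the Lagrangian is bounded below along the iteration, the primal steps must still become small
along some subsequence (`exists_subseq_tendsto_zero_of_decrease`).

Criticality: along a convergent further subsequence the optimality conditions pass to the limit,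
which is feasible. The Taylor inequality for `1 / ‖·‖` then bounds the Lagrangian near the limit
from below by its value there minus a quadratic error (`exists_block_lower_bound`), so zero is a
Fréchet, and hence a limiting, subgradient.
-/

noncomputable section

namespace TNFPlus

/-! ### The nuclear norm of a linear map -/

section SingularValues

open Module

variable {E F : Type*} [NormedAddCommGroup E] [InnerProductSpace ℂ E] [FiniteDimensional ℂ E]
  [NormedAddCommGroup F] [InnerProductSpace ℂ F] [FiniteDimensional ℂ F]

/-- A linear map sends the eigenbasis of `T* T` to an orthogonal family whose norms are the singular
values. -/
theorem inner_map_eigenvectorBasis (T : E →ₗ[ℂ] F) (i j : Fin (finrank ℂ E)) :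
    inner ℂ (T (T.isSymmetric_adjoint_comp_self.eigenvectorBasis rfl i))
      (T (T.isSymmetric_adjoint_comp_self.eigenvectorBasis rfl j)) =
      if i = j then ((T.singularValues i ^ 2 : ℝ) : ℂ) else 0 := by
  have h := T.isSymmetric_adjoint_comp_self.apply_eigenvectorBasis rfl j
  rw [← LinearMap.adjoint_inner_right, ← LinearMap.comp_apply, h, inner_smul_right,
    OrthonormalBasis.inner_eq_ite]
  split_ifs with hij
  · subst hij
    simp [T.sq_singularValues_fin rfl]
  · simp

theorem norm_map_eigenvectorBasis (T : E →ₗ[ℂ] F) (i : Fin (finrank ℂ E)) :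
    ‖T (T.isSymmetric_adjoint_comp_self.eigenvectorBasis rfl i)‖ = T.singularValues i := by
  have h := inner_map_eigenvectorBasis T i i
  rw [if_pos rfl, inner_self_eq_norm_sq_to_K] at h
  have h' : ‖T (T.isSymmetric_adjoint_comp_self.eigenvectorBasis rfl i)‖ ^ 2
      = T.singularValues i ^ 2 := Complex.ofReal_injective (by simpa using h)
  exact (pow_left_inj₀ (norm_nonneg _) (T.singularValues_nonneg _) two_ne_zero).1 h'

/-- One half of the variational description of the nuclear norm: pairing `T` with two finite
orthonormal families never exceeds the sum of the singular values. Expand the second family in the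
eigenbasis of `T* T` and apply the Cauchy–Schwarz and Bessel inequalities to each term. -/
theorem norm_sum_inner_le_sum_singularValues {ι : Type*} [Fintype ι] (T : E →ₗ[ℂ] F)
    {u : ι → F} {v : ι → E} (hu : Orthonormal ℂ u) (hv : Orthonormal ℂ v) :
    ‖∑ j, inner ℂ (u j) (T (v j))‖ ≤ ∑ i ∈ Finset.range (finrank ℂ E), T.singularValues i := by
  set w := T.isSymmetric_adjoint_comp_self.eigenvectorBasis rfl with hw
  have h1 : ∑ j, inner ℂ (u j) (T (v j))
      = ∑ i, ∑ j, inner ℂ (w i) (v j) * inner ℂ (u j) (T (w i)) := by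
    rw [Finset.sum_comm]
    refine Finset.sum_congr rfl fun j _ => ?_
    conv_lhs => rw [← w.sum_repr' (v j)]
    simp only [map_sum, map_smul, inner_sum, inner_smul_right]
  rw [h1, Finset.sum_range]
  refine (norm_sum_le _ _).trans (Finset.sum_le_sum fun i _ => ?_)
  have hA : ∑ j, ‖inner ℂ (w i) (v j)‖ ^ 2 ≤ 1 := by
    have := hv.sum_inner_products_le (w i) (s := Finset.univ)
    rw [w.norm_eq_one] at this
    simpa only [norm_inner_symm (w i), one_pow] using this
  have hB : ∑ j, ‖inner ℂ (u j) (T (w i))‖ ^ 2 ≤ T.singularValues i ^ 2 := by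
    have := hu.sum_inner_products_le (T (w i)) (s := Finset.univ)
    rwa [hw, norm_map_eigenvectorBasis] at this
  have hC := Finset.sum_mul_sq_le_sq_mul_sq Finset.univ (fun j => ‖inner ℂ (w i) (v j)‖)
    (fun j => ‖inner ℂ (u j) (T (w i))‖)
  refine (norm_sum_le _ _).trans ?_
  simp only [norm_mul]
  refine abs_le_of_sq_le_sq' ?_ (T.singularValues_nonneg i) |>.2
  refine hC.trans ((mul_le_mul hA hB (by positivity) zero_le_one).trans (by rw [one_mul]))

/-- The bound of `norm_sum_inner_le_sum_singularValues` is attained. -/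
theorem exists_orthonormal_sum_inner_eq_sum_singularValues (T : E →ₗ[ℂ] F) :
    ∃ (s : Finset (Fin (finrank ℂ E))) (u : s → F) (v : s → E),
      Orthonormal ℂ u ∧ Orthonormal ℂ v ∧
      ∑ j, inner ℂ (u j) (T (v j))
        = ((∑ i ∈ Finset.range (finrank ℂ E), T.singularValues i : ℝ) : ℂ) := by
  set w := T.isSymmetric_adjoint_comp_self.eigenvectorBasis rfl with hw
  let s : Finset (Fin (finrank ℂ E)) := Finset.univ.filter fun i => T.singularValues i ≠ 0
  refine ⟨s, fun i => ((T.singularValues i : ℂ)⁻¹) • T (w i), fun i => w i, ?_,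
    w.orthonormal.comp _ Subtype.val_injective, ?_⟩
  · classical
    rw [orthonormal_iff_ite]
    rintro ⟨i, hi⟩ ⟨j, hj⟩
    have hi' : (T.singularValues i : ℂ) ≠ 0 := by
      exact_mod_cast (Finset.mem_filter.1 hi).2
    simp only [inner_smul_left, inner_smul_right, hw, inner_map_eigenvectorBasis, map_inv₀,
      Complex.conj_ofReal, Subtype.mk.injEq]
    split_ifs with h
    · subst h
      push_cast
      field_simp
    · simp
  · rw [Finset.sum_range, Finset.univ_eq_attach,
      Finset.sum_attach s (fun i => inner ℂ ((T.singularValues i : ℂ)⁻¹ • T (w i)) (T (w i))),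
      Finset.sum_filter]
    push_cast
    refine Finset.sum_congr rfl fun i _ => ?_
    split_ifs with h
    · have hi' : (T.singularValues i : ℂ) ≠ 0 := by exact_mod_cast h
      rw [inner_smul_left, hw, inner_map_eigenvectorBasis, if_pos rfl, map_inv₀,
        Complex.conj_ofReal]
      push_cast
      field_simp
    · rw [not_not.1 h, Complex.ofReal_zero]

theorem sum_singularValues_add_le (S T : E →ₗ[ℂ] F) :
    ∑ i ∈ Finset.range (finrank ℂ E), (S + T).singularValues i ≤
      ∑ i ∈ Finset.range (finrank ℂ E), S.singularValues i +
        ∑ i ∈ Finset.range (finrank ℂ E), T.singularValues i := by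
  obtain ⟨s, u, v, hu, hv, h⟩ := exists_orthonormal_sum_inner_eq_sum_singularValues (S + T)
  have h0 : 0 ≤ ∑ i ∈ Finset.range (finrank ℂ E), (S + T).singularValues i :=
    Finset.sum_nonneg fun i _ => LinearMap.singularValues_nonneg _ _
  rw [← Complex.norm_of_nonneg h0, ← h]
  simp only [LinearMap.add_apply, inner_add_right, Finset.sum_add_distrib]
  exact (norm_add_le _ _).trans (add_le_add (norm_sum_inner_le_sum_singularValues S hu hv)
    (norm_sum_inner_le_sum_singularValues T hu hv))

theorem sum_singularValues_smul_le (c : ℂ) (T : E →ₗ[ℂ] F) :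
    ∑ i ∈ Finset.range (finrank ℂ E), (c • T).singularValues i ≤
      ‖c‖ * ∑ i ∈ Finset.range (finrank ℂ E), T.singularValues i := by
  obtain ⟨s, u, v, hu, hv, h⟩ := exists_orthonormal_sum_inner_eq_sum_singularValues (c • T)
  have h0 : 0 ≤ ∑ i ∈ Finset.range (finrank ℂ E), (c • T).singularValues i :=
    Finset.sum_nonneg fun i _ => LinearMap.singularValues_nonneg _ _
  rw [← Complex.norm_of_nonneg h0, ← h]
  simp only [LinearMap.smul_apply, inner_smul_right, ← Finset.mul_sum, norm_mul]
  exact mul_le_mul_of_nonneg_left (norm_sum_inner_le_sum_singularValues T hu hv) (norm_nonneg _)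

end SingularValues

/-! ### The tensor norms as seminorms -/

/-- The singular values beyond the first `min n₁ n₂` vanish, since the rank is at most `n₁`. -/
theorem matrixNuclearNorm_eq_sum_range_finrank {n₁ n₂ : ℕ} (A : Matrix (Fin n₁) (Fin n₂) ℂ) :
    matrixNuclearNorm A = ∑ i ∈ Finset.range (Module.finrank ℂ (EuclideanSpace ℂ (Fin n₂))),
      (Matrix.toEuclideanLin A).singularValues i := by
  rw [matrixNuclearNorm, finrank_euclideanSpace_fin]
  refine Finset.sum_subset (Finset.range_mono (min_le_right _ _)) fun i hi hi' => ?_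
  rw [LinearMap.singularValues_eq_zero_iff_le_finrank_range]
  rw [Finset.mem_range] at hi hi'
  have h1 : n₁ ≤ i := by omega
  refine (Submodule.finrank_le _).trans ?_
  rwa [finrank_euclideanSpace_fin]

theorem matrixNuclearNorm_nonneg {n₁ n₂ : ℕ} (A : Matrix (Fin n₁) (Fin n₂) ℂ) :
    0 ≤ matrixNuclearNorm A :=
  Finset.sum_nonneg fun _ _ => LinearMap.singularValues_nonneg _ _

theorem matrixNuclearNorm_add_le {n₁ n₂ : ℕ} (A B : Matrix (Fin n₁) (Fin n₂) ℂ) :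
    matrixNuclearNorm (A + B) ≤ matrixNuclearNorm A + matrixNuclearNorm B := by
  simp only [matrixNuclearNorm_eq_sum_range_finrank, map_add]
  exact sum_singularValues_add_le _ _

theorem matrixNuclearNorm_smul_le {n₁ n₂ : ℕ} (c : ℂ) (A : Matrix (Fin n₁) (Fin n₂) ℂ) :
    matrixNuclearNorm (c • A) ≤ ‖c‖ * matrixNuclearNorm A := by
  simp only [matrixNuclearNorm_eq_sum_range_finrank, map_smul]
  exact sum_singularValues_smul_le _ _

section TensorSeminorms

variable {n₁ n₂ n₃ : ℕ}

theorem fourierSlice_add (A B : Tensor n₁ n₂ n₃) (k : Fin n₃) :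
    fourierSlice (A + B) k = fourierSlice A k + fourierSlice B k := by
  ext i j
  simp [fourierSlice, add_mul, Finset.sum_add_distrib]

theorem fourierSlice_smul (c : ℝ) (A : Tensor n₁ n₂ n₃) (k : Fin n₃) :
    fourierSlice (c • A) k = (c : ℂ) • fourierSlice A k := by
  ext i j
  simp [fourierSlice, mul_assoc, Finset.mul_sum]

/-- The tensor nuclear norm, as a seminorm. -/
def nuclearSeminorm (n₁ n₂ n₃ : ℕ) : Seminorm ℝ (Tensor n₁ n₂ n₃) :=
  Seminorm.ofSMulLE nuclearNorm
    (by
      have h : nuclearNorm ((0 : ℝ) • (0 : Tensor n₁ n₂ n₃)) ≤ 0 := by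
        simp only [nuclearNorm, fourierSlice_smul]
        refine mul_nonpos_of_nonneg_of_nonpos (by positivity) (Finset.sum_nonpos fun k _ => ?_)
        exact (matrixNuclearNorm_smul_le _ _).trans (by simp)
      rw [smul_zero] at h
      exact le_antisymm h (mul_nonneg (by positivity)
        (Finset.sum_nonneg fun k _ => matrixNuclearNorm_nonneg _)))
    (fun A B => by
      simp only [nuclearNorm, fourierSlice_add]
      rw [← mul_add, ← Finset.sum_add_distrib]
      gcongr
      exact matrixNuclearNorm_add_le _ _)
    (fun c A => by
      simp only [nuclearNorm, fourierSlice_smul]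
      rw [mul_left_comm, Finset.mul_sum _ _ ‖c‖]
      gcongr
      exact (matrixNuclearNorm_smul_le _ _).trans (by simp))

/-- The `ℓ₁` norm of a tensor, as a seminorm. -/
def l1Seminorm (n₁ n₂ n₃ : ℕ) : Seminorm ℝ (Tensor n₁ n₂ n₃) :=
  Seminorm.of l1Norm
    (fun A B => by
      simp only [l1Norm, ← Finset.sum_add_distrib]
      exact Finset.sum_le_sum fun p _ => abs_add_le _ _)
    (fun c A => by simp [l1Norm, abs_mul, Finset.mul_sum])

theorem nuclearSeminorm_apply (A : Tensor n₁ n₂ n₃) :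
    nuclearSeminorm n₁ n₂ n₃ A = nuclearNorm A := rfl

end TensorSeminorms

/-! ### Elementary estimates in an inner product space -/

section Steps

open Filter Topology

variable {V : Type*} [NormedAddCommGroup V] [InnerProductSpace ℝ V]

theorem exists_seminorm_le_mul_norm [FiniteDimensional ℝ V] (p : Seminorm ℝ V) :
    ∃ C, 0 < C ∧ ∀ x, p x ≤ C * ‖x‖ :=
  p.bound_of_continuous_normedSpace p.convexOn.locallyLipschitz.continuous

theorem abs_seminorm_sub_le {p : Seminorm ℝ V} {C : ℝ} (hC : ∀ x, p x ≤ C * ‖x‖) (x y : V) :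
    |p x - p y| ≤ C * ‖x - y‖ :=
  (abs_sub_map_le_sub p x y).trans (hC _)

theorem nonpos_of_eventually_le_mul {c K : ℝ} (h : ∀ᶠ t : ℝ in 𝓝[>] 0, c ≤ t * K) : c ≤ 0 := by
  have ht : Tendsto (fun t : ℝ => t * K) (𝓝[>] 0) (𝓝 0) := by
    have : Tendsto (fun t : ℝ => t * K) (𝓝 0) (𝓝 (0 * K)) :=
      (continuous_id.mul continuous_const).tendsto 0
    rw [zero_mul] at this
    exact this.mono_left nhdsWithin_le_nhds
  exact ge_of_tendsto ht h

/-- Second-order expansion of a penalty term `μ / 2 * ‖T - A‖ ^ 2 + ⟪Y, T - A⟫` around `L`. -/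
theorem penalty_expand_left (μ : ℝ) (A Y L T : V) :
    μ / 2 * ‖T - A‖ ^ 2 + inner ℝ Y (T - A) = μ / 2 * ‖L - A‖ ^ 2 + inner ℝ Y (L - A)
      + inner ℝ (Y + μ • (L - A)) (T - L) + μ / 2 * ‖T - L‖ ^ 2 := by
  have h : T - A = (L - A) + (T - L) := by abel
  rw [h, norm_add_sq_real, inner_add_right, inner_add_left, real_inner_smul_left]
  ring

/-- Second-order expansion of a penalty term `μ / 2 * ‖L - T‖ ^ 2 + ⟪Y, L - T⟫` around `H`. -/
theorem penalty_expand_right (μ : ℝ) (L Y H T : V) :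
    μ / 2 * ‖L - T‖ ^ 2 + inner ℝ Y (L - T) = μ / 2 * ‖L - H‖ ^ 2 + inner ℝ Y (L - H)
      - inner ℝ (Y + μ • (L - H)) (T - H) + μ / 2 * ‖T - H‖ ^ 2 := by
  have h : L - T = (L - H) - (T - H) := by abel
  rw [h, norm_sub_sq_real, inner_sub_right Y, inner_add_left, real_inner_smul_left]
  ring

/-- The first-order Taylor remainder of `1 / ‖·‖` at `S`, in closed form. -/
theorem one_div_norm_remainder {S T : V} (hS : S ≠ 0) (hT : T ≠ 0) :
    1 / ‖T‖ - (1 / ‖S‖ - inner ℝ S (T - S) / ‖S‖ ^ 3) =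
      (‖T‖ - ‖S‖) ^ 2 * (‖T‖ + 2 * ‖S‖) / (2 * ‖S‖ ^ 3 * ‖T‖) - ‖T - S‖ ^ 2 / (2 * ‖S‖ ^ 3) := by
  have h : inner ℝ S (T - S) = (‖T‖ ^ 2 - ‖S‖ ^ 2 - ‖T - S‖ ^ 2) / 2 := by
    have h1 : T = S + (T - S) := by abel
    have h2 := norm_add_sq_real S (T - S)
    rw [← h1] at h2
    linarith
  have hS' := norm_ne_zero_iff.2 hS
  have hT' := norm_ne_zero_iff.2 hT
  rw [h]
  field_simp
  ring

/-- The function `1 / ‖·‖` is weakly convex away from the origin, with a modulus that depends only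
on the base point. -/
theorem one_div_norm_ge {S T : V} (hS : S ≠ 0) (hT : T ≠ 0) :
    1 / ‖S‖ - inner ℝ S (T - S) / ‖S‖ ^ 3 - ‖T - S‖ ^ 2 / (2 * ‖S‖ ^ 3) ≤ 1 / ‖T‖ := by
  have h := one_div_norm_remainder hS hT
  have h0 : 0 ≤ (‖T‖ - ‖S‖) ^ 2 * (‖T‖ + 2 * ‖S‖) / (2 * ‖S‖ ^ 3 * ‖T‖) := by positivity
  linarith

theorem one_div_norm_le {S T : V} (hS : S ≠ 0) (hT : ‖S‖ / 2 ≤ ‖T‖) :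
    1 / ‖T‖ ≤ 1 / ‖S‖ - inner ℝ S (T - S) / ‖S‖ ^ 3 + 5 / 2 / ‖S‖ ^ 3 * ‖T - S‖ ^ 2 := by
  have hS' := norm_pos_iff.2 hS
  have hT' : 0 < ‖T‖ := by linarith
  have h := one_div_norm_remainder hS (norm_pos_iff.1 hT')
  have h1 : (‖T‖ - ‖S‖) ^ 2 ≤ ‖T - S‖ ^ 2 :=
    sq_le_sq.2 ((abs_norm_sub_norm_le T S).trans (le_abs_self _))
  have h2 : (‖T‖ + 2 * ‖S‖) / (2 * ‖S‖ ^ 3 * ‖T‖) ≤ 5 / 2 / ‖S‖ ^ 3 := by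
    rw [div_div, div_le_div_iff₀ (by positivity) (by positivity)]
    nlinarith [pow_pos hS' 3]
  have h3 : (‖T‖ - ‖S‖) ^ 2 * (‖T‖ + 2 * ‖S‖) / (2 * ‖S‖ ^ 3 * ‖T‖)
      ≤ 5 / 2 / ‖S‖ ^ 3 * ‖T - S‖ ^ 2 := by
    rw [mul_div_assoc, mul_comm (5 / 2 / ‖S‖ ^ 3)]
    exact mul_le_mul h1 h2 (by positivity) (by positivity)
  have h4 : 0 ≤ ‖T - S‖ ^ 2 / (2 * ‖S‖ ^ 3) := by positivity
  linarith

theorem norm_inv_cube_smul_self {x : V} (hx : x ≠ 0) : ‖(1 / ‖x‖ ^ 3) • x‖ = 1 / ‖x‖ ^ 2 := by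
  have := norm_ne_zero_iff.2 hx
  rw [norm_smul, Real.norm_of_nonneg (by positivity)]
  field_simp

/-- The gradient `x / ‖x‖ ^ 3` of `-1 / ‖·‖` is Lipschitz outside any ball around the origin. -/
theorem norm_inv_cube_smul_sub_le {δ : ℝ} (hδ : 0 < δ) {x y : V} (hx : δ ≤ ‖x‖) (hy : δ ≤ ‖y‖) :
    ‖(1 / ‖x‖ ^ 3) • x - (1 / ‖y‖ ^ 3) • y‖ ≤ 4 / δ ^ 3 * ‖x - y‖ := by
  have hx0 : 0 < ‖x‖ := hδ.trans_le hx
  have hy0 : 0 < ‖y‖ := hδ.trans_le hy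
  have e : (1 / ‖x‖ ^ 3) • x - (1 / ‖y‖ ^ 3) • y
      = (1 / ‖x‖ ^ 3) • (x - y) + (1 / ‖x‖ ^ 3 - 1 / ‖y‖ ^ 3) • y := by module
  have e2 : (1 / ‖x‖ ^ 3 - 1 / ‖y‖ ^ 3) * ‖y‖ = (‖y‖ - ‖x‖) *
      (1 / (‖x‖ ^ 3) + 1 / (‖x‖ ^ 2 * ‖y‖) + 1 / (‖x‖ * ‖y‖ ^ 2)) := by
    field_simp
    ring
  have h1 : 1 / ‖x‖ ^ 3 ≤ 1 / δ ^ 3 := by gcongr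
  have h2 : 1 / (‖x‖ ^ 2 * ‖y‖) ≤ 1 / δ ^ 3 := by
    rw [pow_succ δ 2]
    gcongr
  have h3 : 1 / (‖x‖ * ‖y‖ ^ 2) ≤ 1 / δ ^ 3 := by
    rw [pow_succ' δ 2]
    gcongr
  have h4 : |‖y‖ - ‖x‖| ≤ ‖x - y‖ := by
    rw [norm_sub_rev]
    exact abs_norm_sub_norm_le y x
  rw [e]
  refine (norm_add_le _ _).trans ?_
  rw [norm_smul, norm_smul, Real.norm_of_nonneg (by positivity : 0 ≤ 1 / ‖x‖ ^ 3), Real.norm_eq_abs,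
    ← abs_of_nonneg (norm_nonneg y), ← abs_mul, abs_of_nonneg (norm_nonneg y), e2, abs_mul,
    abs_of_nonneg (by positivity :
      0 ≤ 1 / (‖x‖ ^ 3) + 1 / (‖x‖ ^ 2 * ‖y‖) + 1 / (‖x‖ * ‖y‖ ^ 2))]
  calc 1 / ‖x‖ ^ 3 * ‖x - y‖ + |‖y‖ - ‖x‖| *
        (1 / (‖x‖ ^ 3) + 1 / (‖x‖ ^ 2 * ‖y‖) + 1 / (‖x‖ * ‖y‖ ^ 2))
      ≤ 1 / δ ^ 3 * ‖x - y‖ + ‖x - y‖ * (1 / δ ^ 3 + 1 / δ ^ 3 + 1 / δ ^ 3) := by gcongr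
    _ = 4 / δ ^ 3 * ‖x - y‖ := by ring

/-! ### Optimality conditions and decrease in one minimization step -/

/-- First-order optimality for a minimizer `L` of a positively scaled seminorm plus two penalty
terms: minus the gradient of the penalties at `L` is a subgradient of the seminorm part. -/
theorem seminorm_variational_of_min (p : Seminorm ℝ V) {h μ ν : ℝ} (hh : 0 ≤ h) {A B Y Z L : V}
    (hmin : ∀ T, p L / h + (μ / 2 * ‖L - A‖ ^ 2 + inner ℝ Y (L - A))
        + (ν / 2 * ‖L - B‖ ^ 2 + inner ℝ Z (L - B)) ≤
      p T / h + (μ / 2 * ‖T - A‖ ^ 2 + inner ℝ Y (T - A))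
        + (ν / 2 * ‖T - B‖ ^ 2 + inner ℝ Z (T - B))) (T : V) :
    p L / h ≤ p T / h + inner ℝ (Y + μ • (L - A) + (Z + ν • (L - B))) (T - L) := by
  rw [← sub_nonpos]
  refine nonpos_of_eventually_le_mul (K := (μ + ν) / 2 * ‖T - L‖ ^ 2) ?_
  filter_upwards [Ioo_mem_nhdsGT (zero_lt_one' ℝ)] with t ht
  have h1 := hmin (L + t • (T - L))
  rw [penalty_expand_left μ A Y L (L + t • (T - L)),
    penalty_expand_left ν B Z L (L + t • (T - L)), add_sub_cancel_left, norm_smul,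
    Real.norm_of_nonneg ht.1.le, real_inner_smul_right, real_inner_smul_right] at h1
  have h2 : p (L + t • (T - L)) ≤ (1 - t) * p L + t * p T := by
    have e : L + t • (T - L) = (1 - t) • L + t • T := by module
    rw [e]
    refine (map_add_le_add p _ _).trans ?_
    rw [map_smul_eq_mul, map_smul_eq_mul, Real.norm_of_nonneg ht.1.le,
      Real.norm_of_nonneg (by linarith [ht.2])]
  have h3 : p (L + t • (T - L)) / h ≤ (1 - t) * (p L / h) + t * (p T / h) := by
    refine (div_le_div_of_nonneg_right h2 hh).trans (le_of_eq ?_)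
    ring
  rw [inner_add_left]
  refine le_of_mul_le_mul_left ?_ ht.1
  nlinarith

/-- The decrease in a minimization step whose objective is a scaled seminorm plus two penalty
terms. -/
theorem seminorm_step_decrease (p : Seminorm ℝ V) {h μ ν : ℝ} (hh : 0 ≤ h) {A B Y Z L : V}
    (hmin : ∀ T, p L / h + (μ / 2 * ‖L - A‖ ^ 2 + inner ℝ Y (L - A))
        + (ν / 2 * ‖L - B‖ ^ 2 + inner ℝ Z (L - B)) ≤
      p T / h + (μ / 2 * ‖T - A‖ ^ 2 + inner ℝ Y (T - A))
        + (ν / 2 * ‖T - B‖ ^ 2 + inner ℝ Z (T - B))) (T : V) :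
    p L / h + (μ / 2 * ‖L - A‖ ^ 2 + inner ℝ Y (L - A))
        + (ν / 2 * ‖L - B‖ ^ 2 + inner ℝ Z (L - B)) + (μ + ν) / 2 * ‖L - T‖ ^ 2 ≤
      p T / h + (μ / 2 * ‖T - A‖ ^ 2 + inner ℝ Y (T - A))
        + (ν / 2 * ‖T - B‖ ^ 2 + inner ℝ Z (T - B)) := by
  have h1 := seminorm_variational_of_min p hh hmin T
  rw [inner_add_left] at h1
  rw [penalty_expand_left μ A Y L T, penalty_expand_left ν B Z L T, norm_sub_rev L T]
  linarith

/-- Stationarity of a minimizer `H ≠ 0` of a multiple of `1 / ‖·‖` plus a penalty term. -/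
theorem one_div_norm_stationary {a μ : ℝ} (ha : 0 ≤ a) {L Y H : V} (hH : H ≠ 0)
    (hmin : ∀ T, T ≠ 0 → a / ‖H‖ + (μ / 2 * ‖L - H‖ ^ 2 + inner ℝ Y (L - H)) ≤
      a / ‖T‖ + (μ / 2 * ‖L - T‖ ^ 2 + inner ℝ Y (L - T))) :
    Y + μ • (L - H) = -(a • (1 / ‖H‖ ^ 3) • H) := by
  set G := Y + μ • (L - H) + a • (1 / ‖H‖ ^ 3) • H with hG
  suffices hG0 : G = 0 by rw [hG] at hG0; exact eq_neg_of_add_eq_zero_left hG0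
  have hH' := norm_pos_iff.2 hH
  suffices h0 : ‖G‖ ^ 2 ≤ 0 by
    exact norm_eq_zero.1 (pow_eq_zero_iff two_ne_zero |>.1 (le_antisymm h0 (sq_nonneg _)))
  refine nonpos_of_eventually_le_mul
    (K := (a * (5 / 2 / ‖H‖ ^ 3) + μ / 2) * ‖G‖ ^ 2) ?_
  have hc : Tendsto (fun t : ℝ => ‖H + t • G‖) (𝓝[>] 0) (𝓝 ‖H‖) := by
    have : Tendsto (fun t : ℝ => ‖H + t • G‖) (𝓝 0) (𝓝 ‖H + (0 : ℝ) • G‖) :=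
      (by fun_prop : Continuous fun t : ℝ => ‖H + t • G‖).tendsto 0
    rw [zero_smul, add_zero] at this
    exact this.mono_left nhdsWithin_le_nhds
  filter_upwards [self_mem_nhdsWithin, hc.eventually (lt_mem_nhds (half_lt_self hH'))] with t ht hn
  have ht' : 0 < t := ht
  have hT : H + t • G ≠ 0 := norm_pos_iff.1 ((half_pos hH').trans hn)
  have h1 := hmin _ hT
  have h2 := mul_le_mul_of_nonneg_left (one_div_norm_le hH hn.le) ha
  have hi : inner ℝ (Y + μ • (L - H)) G = ‖G‖ ^ 2 - a * (1 / ‖H‖ ^ 3) * inner ℝ H G := by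
    rw [eq_sub_iff_add_eq, ← real_inner_self_eq_norm_sq]
    conv_rhs => rw [hG, inner_add_left]
    rw [real_inner_smul_left, real_inner_smul_left, ← hG, mul_assoc]
  rw [penalty_expand_right μ L Y H (H + t • G), add_sub_cancel_left, real_inner_smul_right, hi,
    norm_smul, Real.norm_of_nonneg ht'.le] at h1
  rw [add_sub_cancel_left, real_inner_smul_right, norm_smul, Real.norm_of_nonneg ht'.le,
    mul_one_div] at h2
  refine le_of_mul_le_mul_left ?_ ht'
  have e : a * (1 / ‖H‖ - t * inner ℝ H G / ‖H‖ ^ 3 + 5 / 2 / ‖H‖ ^ 3 * (t * ‖G‖) ^ 2)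
      = a / ‖H‖ - t * (a * (1 / ‖H‖ ^ 3) * inner ℝ H G)
        + a * (5 / 2 / ‖H‖ ^ 3) * t ^ 2 * ‖G‖ ^ 2 := by
    ring
  rw [e] at h2
  nlinarith

/-- The decrease in a minimization step over the denominator. The objective is not convex, but
its penalty term outweighs the weak convexity modulus of `a / ‖·‖` once `μ` is large. -/
theorem one_div_norm_step_decrease {a μ : ℝ} (ha : 0 ≤ a) {L Y H : V} (hH : H ≠ 0)
    (hmin : ∀ T, T ≠ 0 → a / ‖H‖ + (μ / 2 * ‖L - H‖ ^ 2 + inner ℝ Y (L - H)) ≤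
      a / ‖T‖ + (μ / 2 * ‖L - T‖ ^ 2 + inner ℝ Y (L - T))) {T : V} (hT : T ≠ 0) :
    a / ‖H‖ + (μ / 2 * ‖L - H‖ ^ 2 + inner ℝ Y (L - H))
        + (μ / 2 - a / (2 * ‖H‖ ^ 3)) * ‖H - T‖ ^ 2 ≤
      a / ‖T‖ + (μ / 2 * ‖L - T‖ ^ 2 + inner ℝ Y (L - T)) := by
  have h1 := mul_le_mul_of_nonneg_left (one_div_norm_ge hH hT) ha
  rw [penalty_expand_right μ L Y H T, one_div_norm_stationary ha hH hmin, inner_neg_left,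
    real_inner_smul_left, real_inner_smul_left, norm_sub_rev H T]
  have e : a * (1 / ‖H‖ - inner ℝ H (T - H) / ‖H‖ ^ 3 - ‖T - H‖ ^ 2 / (2 * ‖H‖ ^ 3))
      = a / ‖H‖ - a * (1 / ‖H‖ ^ 3 * inner ℝ H (T - H)) - a / (2 * ‖H‖ ^ 3) * ‖T - H‖ ^ 2 := by
    ring
  rw [e, mul_one_div] at h1
  linarith

/-- A multiplier of the form given by `one_div_norm_stationary` is bounded. -/
theorem norm_smul_inv_cube_smul_le {δ M a : ℝ} (hδ : 0 < δ) (ha : 0 ≤ a) (haM : a ≤ M) {x : V}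
    (hx : δ ≤ ‖x‖) : ‖a • (1 / ‖x‖ ^ 3) • x‖ ≤ M / δ ^ 2 := by
  rw [norm_smul, norm_inv_cube_smul_self (norm_pos_iff.1 (hδ.trans_le hx)),
    Real.norm_of_nonneg ha, div_eq_mul_one_div M]
  have := ha.trans haM
  gcongr

/-- Multipliers of the form given by `one_div_norm_stationary` vary in a Lipschitz way with the
primal variables. -/
theorem norm_smul_inv_cube_smul_sub_le {δ M a b : ℝ} (hδ : 0 < δ) (hb : 0 ≤ b) (hbM : b ≤ M)
    {x y : V} (hx : δ ≤ ‖x‖) (hy : δ ≤ ‖y‖) :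
    ‖a • (1 / ‖x‖ ^ 3) • x - b • (1 / ‖y‖ ^ 3) • y‖ ≤
      |a - b| / δ ^ 2 + M * (4 / δ ^ 3) * ‖x - y‖ := by
  have e : a • (1 / ‖x‖ ^ 3) • x - b • (1 / ‖y‖ ^ 3) • y
      = (a - b) • (1 / ‖x‖ ^ 3) • x + b • ((1 / ‖x‖ ^ 3) • x - (1 / ‖y‖ ^ 3) • y) := by module
  rw [e]
  refine (norm_add_le _ _).trans (add_le_add ?_ ?_)
  · rw [norm_smul, norm_inv_cube_smul_self (norm_pos_iff.1 (hδ.trans_le hx)), Real.norm_eq_abs,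
      div_eq_mul_one_div |a - b|]
    gcongr
  · rw [norm_smul, Real.norm_of_nonneg hb, mul_assoc]
    exact mul_le_mul hbM (norm_inv_cube_smul_sub_le hδ hx hy) (norm_nonneg _) (hb.trans hbM)

/-- For a large penalty parameter `μ`, the primal decrease absorbs the increase `dY ^ 2 / μ` caused
by a multiplier update, if the multiplier changes in a Lipschitz way with the primal variables. -/
theorem half_sq_le_decrease_sub_dual {α β κ μ dL dH dY : ℝ} (hκ : 0 ≤ κ)
    (hμ : 1 + 4 * α ^ 2 + 4 * β ^ 2 + 2 * κ ≤ μ) (hdY : 0 ≤ dY) (h : dY ≤ α * dL + β * dH) :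
    1 / 2 * (dL ^ 2 + dH ^ 2) ≤ μ / 2 * dL ^ 2 + (μ / 2 - κ) * dH ^ 2 - dY ^ 2 / μ := by
  have hμ1 : 1 ≤ μ := by nlinarith [sq_nonneg α, sq_nonneg β]
  have h1 : dY ^ 2 ≤ 2 * α ^ 2 * dL ^ 2 + 2 * β ^ 2 * dH ^ 2 := by
    have := pow_le_pow_left₀ hdY h 2
    nlinarith [sq_nonneg (α * dL - β * dH)]
  have h2 : dY ^ 2 / μ ≤ dY ^ 2 := div_le_self (sq_nonneg _) hμ1
  nlinarith [mul_nonneg (sub_nonneg.2 hμ) (sq_nonneg dL),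
    mul_nonneg (sub_nonneg.2 hμ) (sq_nonneg dH), mul_nonneg (sq_nonneg β) (sq_nonneg dL),
    mul_nonneg (sq_nonneg α) (sq_nonneg dH), mul_nonneg hκ (sq_nonneg dL)]

/-- The negative of a subgradient of `p / h` has norm at most `C / δ` if `p ≤ C * ‖·‖` and
`δ ≤ h`. -/
theorem norm_le_of_seminorm_variational {p : Seminorm ℝ V} {C δ h : ℝ} (hC0 : 0 ≤ C)
    (hC : ∀ x, p x ≤ C * ‖x‖) (hδ : 0 < δ) (hh : δ ≤ h) {G L : V}
    (hvar : ∀ T, p L / h ≤ p T / h + inner ℝ G (T - L)) : ‖G‖ ≤ C / δ := by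
  have h1 := hvar (L - G)
  rw [sub_sub_cancel_left, inner_neg_right, real_inner_self_eq_norm_sq] at h1
  have hh0 : 0 < h := hδ.trans_le hh
  have h2 : p (L - G) / h - p L / h ≤ C / δ * ‖G‖ := by
    rw [← sub_div]
    have h3 : p (L - G) - p L ≤ C * ‖G‖ := by
      have := (le_abs_self _).trans (abs_seminorm_sub_le hC (L - G) L)
      rwa [sub_sub_cancel_left, norm_neg] at this
    calc (p (L - G) - p L) / h ≤ C * ‖G‖ / h := by gcongr
      _ ≤ C * ‖G‖ / δ := by gcongr
      _ = C / δ * ‖G‖ := by ring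
  by_contra! hlt
  have : 0 < ‖G‖ := (div_nonneg hC0 hδ.le).trans_lt hlt
  nlinarith

/-! ### A quadratic lower bound at a critical point -/

/-- Quadratic lower bound for a numerator–denominator block of the Lagrangian around a point where
the block constraint `L = H` and the optimality conditions hold. The multipliers enter as
variables, too. -/
theorem exists_block_lower_bound [FiniteDimensional ℝ V] (p : Seminorm ℝ V) {μ : ℝ} (hμ : 0 ≤ μ)
    {L Y Z : V} (hL : L ≠ 0) (hY : Y = -(p L • (1 / ‖L‖ ^ 3) • L))
    (hvar : ∀ T, p L / ‖L‖ ≤ p T / ‖L‖ + inner ℝ (Y + Z) (T - L)) :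
    ∃ K, 0 ≤ K ∧ ∀ (r : ℝ) (L' H' Y' : V), r ≤ 1 → H' ≠ 0 → ‖L' - L‖ ≤ r → ‖H' - L‖ ≤ r →
      ‖Y' - Y‖ ≤ r → p L / ‖L‖ - inner ℝ Z (L' - L) - K * r ^ 2 ≤
        p L' / ‖H'‖ + (μ / 2 * ‖L' - H'‖ ^ 2 + inner ℝ Y' (L' - H')) := by
  obtain ⟨C, hC0, hC⟩ := exists_seminorm_le_mul_norm p
  have hn := norm_pos_iff.2 hL
  have hpL := apply_nonneg p L
  refine ⟨C / ‖L‖ ^ 2 + (p L + C) / (2 * ‖L‖ ^ 3) + 2, by positivity, ?_⟩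
  intro r L' H' Y' hr hH' hLr hHr hYr
  have hr0 : 0 ≤ r := (norm_nonneg _).trans hLr
  have hpL' := apply_nonneg p L'
  have h1 := mul_le_mul_of_nonneg_left (one_div_norm_ge hL hH') hpL'
  have hd := abs_seminorm_sub_le hC L' L
  have hd' : |p L' - p L| ≤ C * r := hd.trans (by gcongr)
  -- the mixed second-order term of the quotient
  have h2 : (p L' - p L) * (inner ℝ L (H' - L) / ‖L‖ ^ 3) ≤ C / ‖L‖ ^ 2 * r ^ 2 := by
    refine (le_abs_self _).trans ?_
    rw [abs_mul, abs_div, abs_of_pos (pow_pos hn 3)]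
    have h3 : |inner ℝ L (H' - L)| ≤ ‖L‖ * r :=
      (abs_real_inner_le_norm _ _).trans (by gcongr)
    calc |p L' - p L| * (|inner ℝ L (H' - L)| / ‖L‖ ^ 3)
        ≤ C * r * (‖L‖ * r / ‖L‖ ^ 3) := by gcongr
      _ = C / ‖L‖ ^ 2 * r ^ 2 := by field_simp
  have h4 : p L' * (‖H' - L‖ ^ 2 / (2 * ‖L‖ ^ 3)) ≤ (p L + C) / (2 * ‖L‖ ^ 3) * r ^ 2 := by
    have h5 : p L' ≤ p L + C := by nlinarith [(le_abs_self _).trans hd']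
    calc p L' * (‖H' - L‖ ^ 2 / (2 * ‖L‖ ^ 3))
        ≤ (p L + C) * (r ^ 2 / (2 * ‖L‖ ^ 3)) := by gcongr
      _ = (p L + C) / (2 * ‖L‖ ^ 3) * r ^ 2 := by ring
  have h6 : -(2 * r ^ 2) ≤ inner ℝ (Y' - Y) (L' - H') := by
    have h7 : ‖L' - H'‖ ≤ 2 * r := by
      have : L' - H' = (L' - L) - (H' - L) := by abel
      rw [this]
      exact (norm_sub_le _ _).trans (by linarith)
    have h8 : |inner ℝ (Y' - Y) (L' - H')| ≤ r * (2 * r) :=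
      (abs_real_inner_le_norm _ _).trans (by gcongr)
    nlinarith [neg_abs_le (inner ℝ (Y' - Y) (L' - H'))]
  have h9 := hvar L'
  have h10 : inner ℝ Y (H' - L) = -(p L * (inner ℝ L (H' - L) / ‖L‖ ^ 3)) := by
    rw [hY, inner_neg_left, real_inner_smul_left, real_inner_smul_left]
    ring
  have h11 : inner ℝ Y' (L' - H') = inner ℝ (Y' - Y) (L' - H') + inner ℝ Y (L' - L)
      - inner ℝ Y (H' - L) := by
    rw [inner_sub_left, add_sub_assoc, ← inner_sub_right, sub_sub_sub_cancel_right]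
    ring
  have h12 : 0 ≤ μ / 2 * ‖L' - H'‖ ^ 2 := by positivity
  rw [inner_add_left] at h9
  rw [mul_one_div] at h1
  have e : p L' * (1 / ‖L‖ - inner ℝ L (H' - L) / ‖L‖ ^ 3 - ‖H' - L‖ ^ 2 / (2 * ‖L‖ ^ 3))
      = p L' / ‖L‖ - (p L' - p L) * (inner ℝ L (H' - L) / ‖L‖ ^ 3)
        - p L * (inner ℝ L (H' - L) / ‖L‖ ^ 3)
        - p L' * (‖H' - L‖ ^ 2 / (2 * ‖L‖ ^ 3)) := by ring
  rw [e] at h1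
  rw [h11, h10]
  linarith

/-- A function bounded below that decreases by `s k` up to an error tending to zero has steps `s k`
that become small along a subsequence. -/
theorem exists_subseq_tendsto_zero_of_decrease {f s z : ℕ → ℝ} {B : ℝ} (hB : ∀ k, B ≤ f k)
    (hs : ∀ k, 0 ≤ s k) (hz : Tendsto z atTop (𝓝 0))
    (hdec : ∀ᶠ k in atTop, f (k + 1) + s k ≤ f k + z k) :
    ∃ φ : ℕ → ℕ, StrictMono φ ∧ Tendsto (s ∘ φ) atTop (𝓝 0) := by
  have hfreq : ∀ n : ℕ, ∃ᶠ k in atTop, s k < 1 / ((n : ℝ) + 1) := by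
    intro n hn
    have hε : (0 : ℝ) < 1 / ((n : ℝ) + 1) / 2 := by positivity
    obtain ⟨N, hN⟩ := eventually_atTop.1 ((hn.and hdec).and (hz.eventually (gt_mem_nhds hε)))
    have hlin : ∀ j : ℕ, f (N + j) ≤ f N - j * (1 / ((n : ℝ) + 1) / 2) := by
      intro j
      induction j with
      | zero => simp
      | succ j ih =>
        obtain ⟨⟨h1, h2⟩, h3⟩ := hN (N + j) (by omega)
        rw [not_lt] at h1
        push_cast
        rw [← add_assoc]
        linarith
    obtain ⟨j, hj⟩ := exists_nat_gt ((f N - B) / (1 / ((n : ℝ) + 1) / 2))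
    rw [div_lt_iff₀ hε] at hj
    linarith [hlin j, hB (N + j)]
  obtain ⟨φ, hφ, h⟩ := extraction_forall_of_frequently hfreq
  exact ⟨φ, hφ, squeeze_zero (fun n => hs _) (fun n => (h n).le)
    tendsto_one_div_add_atTop_nhds_zero_nat⟩

end Steps

section ADMM

open Filter Topology

variable {n₁ n₂ n₃ : ℕ}

/-! ### The Lagrangian in block form -/

/-- The weighted `ℓ₁` norm `lam * ‖·‖₁`, as a seminorm. -/
def weightedL1Seminorm (n₁ n₂ n₃ : ℕ) {lam : ℝ} (hlam : 0 ≤ lam) :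
    Seminorm ℝ (Tensor n₁ n₂ n₃) :=
  let c : NNReal := ⟨lam, hlam⟩
  c • l1Seminorm n₁ n₂ n₃

theorem weightedL1Seminorm_apply {lam : ℝ} (hlam : 0 ≤ lam) (A : Tensor n₁ n₂ n₃) :
    weightedL1Seminorm n₁ n₂ n₃ hlam A = lam * l1Norm A := rfl

theorem augLagrangian_eq_blocks {X : Tensor n₁ n₂ n₃} {lam μ₁ μ₂ μ₃ : ℝ} (hlam : 0 ≤ lam)
    (L H E D Y Z U : Tensor n₁ n₂ n₃) :
    augLagrangian X lam μ₁ μ₂ μ₃ L H E D Y Z U =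
      nuclearSeminorm n₁ n₂ n₃ L / ‖H‖ + (μ₁ / 2 * ‖L - H‖ ^ 2 + inner ℝ Y (L - H))
        + (weightedL1Seminorm n₁ n₂ n₃ hlam E / ‖D‖
          + (μ₃ / 2 * ‖E - D‖ ^ 2 + inner ℝ U (E - D)))
        + (μ₂ / 2 * ‖L + E - X‖ ^ 2 + inner ℝ Z (L + E - X)) := by
  rw [augLagrangian, nuclearSeminorm_apply, weightedL1Seminorm_apply]
  ring

variable {X : Tensor n₁ n₂ n₃} {lam μ₁ μ₂ μ₃ : ℝ} {L H E D Y Z U : ℕ → Tensor n₁ n₂ n₃}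

theorem IsADMMSequence.L_min (h : IsADMMSequence X lam μ₁ μ₂ μ₃ L H E D Y Z U) (hlam : 0 ≤ lam)
    (k : ℕ) (T : Tensor n₁ n₂ n₃) :
    nuclearSeminorm n₁ n₂ n₃ (L (k + 1)) / ‖H k‖
        + (μ₁ / 2 * ‖L (k + 1) - H k‖ ^ 2 + inner ℝ (Y k) (L (k + 1) - H k))
        + (μ₂ / 2 * ‖L (k + 1) - (X - E k)‖ ^ 2 + inner ℝ (Z k) (L (k + 1) - (X - E k))) ≤
      nuclearSeminorm n₁ n₂ n₃ T / ‖H k‖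
        + (μ₁ / 2 * ‖T - H k‖ ^ 2 + inner ℝ (Y k) (T - H k))
        + (μ₂ / 2 * ‖T - (X - E k)‖ ^ 2 + inner ℝ (Z k) (T - (X - E k))) := by
  have h1 := isMinOn_iff.1 (h.L_update k).2 T (Set.mem_univ _)
  simp only [augLagrangian_eq_blocks hlam] at h1
  simp only [← sub_add, sub_add_eq_add_sub]
  linarith

theorem IsADMMSequence.H_min (h : IsADMMSequence X lam μ₁ μ₂ μ₃ L H E D Y Z U) (hlam : 0 ≤ lam)
    (k : ℕ) (T : Tensor n₁ n₂ n₃) (hT : T ≠ 0) :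
    nuclearSeminorm n₁ n₂ n₃ (L (k + 1)) / ‖H (k + 1)‖
        + (μ₁ / 2 * ‖L (k + 1) - H (k + 1)‖ ^ 2 + inner ℝ (Y k) (L (k + 1) - H (k + 1))) ≤
      nuclearSeminorm n₁ n₂ n₃ (L (k + 1)) / ‖T‖
        + (μ₁ / 2 * ‖L (k + 1) - T‖ ^ 2 + inner ℝ (Y k) (L (k + 1) - T)) := by
  have h1 := isMinOn_iff.1 (h.H_update k).2 T hT
  simp only [augLagrangian_eq_blocks hlam] at h1
  linarith

theorem IsADMMSequence.E_min (h : IsADMMSequence X lam μ₁ μ₂ μ₃ L H E D Y Z U) (hlam : 0 ≤ lam)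
    (k : ℕ) (T : Tensor n₁ n₂ n₃) :
    weightedL1Seminorm n₁ n₂ n₃ hlam (E (k + 1)) / ‖D k‖
        + (μ₃ / 2 * ‖E (k + 1) - D k‖ ^ 2 + inner ℝ (U k) (E (k + 1) - D k))
        + (μ₂ / 2 * ‖E (k + 1) - (X - L (k + 1))‖ ^ 2
          + inner ℝ (Z k) (E (k + 1) - (X - L (k + 1)))) ≤
      weightedL1Seminorm n₁ n₂ n₃ hlam T / ‖D k‖
        + (μ₃ / 2 * ‖T - D k‖ ^ 2 + inner ℝ (U k) (T - D k))
        + (μ₂ / 2 * ‖T - (X - L (k + 1))‖ ^ 2 + inner ℝ (Z k) (T - (X - L (k + 1)))) := by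
  have h1 := isMinOn_iff.1 (h.E_update k).2 T (Set.mem_univ _)
  simp only [augLagrangian_eq_blocks hlam] at h1
  have e : ∀ T, T - (X - L (k + 1)) = L (k + 1) + T - X := fun T => by abel
  simp only [e]
  linarith

theorem IsADMMSequence.D_min (h : IsADMMSequence X lam μ₁ μ₂ μ₃ L H E D Y Z U) (hlam : 0 ≤ lam)
    (k : ℕ) (T : Tensor n₁ n₂ n₃) (hT : T ≠ 0) :
    weightedL1Seminorm n₁ n₂ n₃ hlam (E (k + 1)) / ‖D (k + 1)‖
        + (μ₃ / 2 * ‖E (k + 1) - D (k + 1)‖ ^ 2 + inner ℝ (U k) (E (k + 1) - D (k + 1))) ≤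
      weightedL1Seminorm n₁ n₂ n₃ hlam (E (k + 1)) / ‖T‖
        + (μ₃ / 2 * ‖E (k + 1) - T‖ ^ 2 + inner ℝ (U k) (E (k + 1) - T)) := by
  have h1 := isMinOn_iff.1 (h.D_update k).2 T hT
  simp only [augLagrangian_eq_blocks hlam] at h1
  linarith

/-- After the first iteration, the multiplier `Y` is determined by `L` and `H`. -/
theorem IsADMMSequence.Y_succ (h : IsADMMSequence X lam μ₁ μ₂ μ₃ L H E D Y Z U) (hlam : 0 ≤ lam)
    (k : ℕ) : Y (k + 1) =
      -(nuclearSeminorm n₁ n₂ n₃ (L (k + 1)) • (1 / ‖H (k + 1)‖ ^ 3) • H (k + 1)) := by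
  rw [h.Y_update k]
  exact one_div_norm_stationary (apply_nonneg _ _) (h.H_update k).1 (h.H_min hlam k)

/-- After the first iteration, the multiplier `U` is determined by `E` and `D`. -/
theorem IsADMMSequence.U_succ (h : IsADMMSequence X lam μ₁ μ₂ μ₃ L H E D Y Z U) (hlam : 0 ≤ lam)
    (k : ℕ) : U (k + 1) =
      -(weightedL1Seminorm n₁ n₂ n₃ hlam (E (k + 1)) • (1 / ‖D (k + 1)‖ ^ 3) • D (k + 1)) := by
  rw [h.U_update k]
  exact one_div_norm_stationary (apply_nonneg _ _) (h.D_update k).1 (h.D_min hlam k)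

theorem IsADMMSequence.L_variational (h : IsADMMSequence X lam μ₁ μ₂ μ₃ L H E D Y Z U)
    (hlam : 0 ≤ lam) (k : ℕ) (T : Tensor n₁ n₂ n₃) :
    nuclearSeminorm n₁ n₂ n₃ (L (k + 1)) / ‖H k‖ ≤ nuclearSeminorm n₁ n₂ n₃ T / ‖H k‖
      + inner ℝ (Y k + μ₁ • (L (k + 1) - H k) + (Z k + μ₂ • (L (k + 1) - (X - E k))))
          (T - L (k + 1)) :=
  seminorm_variational_of_min _ (norm_nonneg _) (h.L_min hlam k) T

theorem IsADMMSequence.E_variational (h : IsADMMSequence X lam μ₁ μ₂ μ₃ L H E D Y Z U)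
    (hlam : 0 ≤ lam) (k : ℕ) (T : Tensor n₁ n₂ n₃) :
    weightedL1Seminorm n₁ n₂ n₃ hlam (E (k + 1)) / ‖D k‖
      ≤ weightedL1Seminorm n₁ n₂ n₃ hlam T / ‖D k‖
        + inner ℝ (U k + μ₃ • (E (k + 1) - D k) + Z (k + 1)) (T - E (k + 1)) := by
  have e : Z (k + 1) = Z k + μ₂ • (E (k + 1) - (X - L (k + 1))) := by
    rw [h.Z_update k, ← sub_add, sub_add_eq_add_sub, add_comm (E (k + 1))]
  rw [e]
  exact seminorm_variational_of_min _ (norm_nonneg _) (h.E_min hlam k) T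

/-! ### Boundedness of the iterates -/

theorem isBounded_range_of_norm_succ_le {V : Type*} [NormedAddCommGroup V] {x : ℕ → V} {B : ℝ}
    (hB : ∀ k, ‖x (k + 1)‖ ≤ B) : Bornology.IsBounded (Set.range x) := by
  refine isBounded_iff_forall_norm_le.2 ⟨max ‖x 0‖ B, ?_⟩
  rintro _ ⟨k, rfl⟩
  cases k with
  | zero => exact le_max_left _ _
  | succ k => exact (hB k).trans (le_max_right _ _)

theorem exists_norm_le_of_isBounded_range {V : Type*} [NormedAddCommGroup V] {x : ℕ → V}
    (h : Bornology.IsBounded (Set.range x)) : ∃ B, ∀ k, ‖x k‖ ≤ B := by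
  obtain ⟨B, hB⟩ := isBounded_iff_forall_norm_le.1 h
  exact ⟨B, fun k => hB _ ⟨k, rfl⟩⟩

theorem isBounded_range_of_multiplier_update {V : Type*} [NormedAddCommGroup V] [NormedSpace ℝ V]
    {x y m : ℕ → V} {μ : ℝ} (hμ : 0 < μ) (hx : Bornology.IsBounded (Set.range x))
    (hm : Bornology.IsBounded (Set.range m))
    (hupd : ∀ k, m (k + 1) = m k + μ • (x (k + 1) - y (k + 1))) :
    Bornology.IsBounded (Set.range y) := by
  obtain ⟨Bx, hBx⟩ := exists_norm_le_of_isBounded_range hx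
  obtain ⟨Bm, hBm⟩ := exists_norm_le_of_isBounded_range hm
  refine isBounded_range_of_norm_succ_le (B := Bx + μ⁻¹ * (Bm + Bm)) fun k => ?_
  have e : y (k + 1) = x (k + 1) - μ⁻¹ • (m (k + 1) - m k) := by
    rw [hupd k, add_sub_cancel_left, inv_smul_smul₀ hμ.ne', sub_sub_cancel]
  rw [e]
  refine (norm_sub_le _ _).trans (add_le_add (hBx _) ?_)
  rw [norm_smul, Real.norm_of_nonneg (inv_pos.2 hμ).le]
  gcongr
  exact (norm_sub_le _ _).trans (add_le_add (hBm _) (hBm _))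

variable {M m δ₁ δ₂ : ℝ}

theorem weightedL1Seminorm_le (hlam : 0 ≤ lam) (hb : BoundedIterates L E M m) (k : ℕ) :
    weightedL1Seminorm n₁ n₂ n₃ hlam (E k) ≤ lam * m :=
  mul_le_mul_of_nonneg_left (hb.l1Norm_le k) hlam

theorem IsADMMSequence.isBounded_Y (h : IsADMMSequence X lam μ₁ μ₂ μ₃ L H E D Y Z U)
    (hlam : 0 ≤ lam) (hδ₁ : 0 < δ₁) (hb : BoundedIterates L E M m)
    (hd : DenominatorsBoundedBelow H D δ₁ δ₂) : Bornology.IsBounded (Set.range Y) :=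
  isBounded_range_of_norm_succ_le fun k => by
    rw [h.Y_succ hlam, norm_neg]
    exact norm_smul_inv_cube_smul_le hδ₁ (apply_nonneg _ _) (hb.nuclearNorm_le _) (hd.H_le _)

theorem IsADMMSequence.isBounded_U (h : IsADMMSequence X lam μ₁ μ₂ μ₃ L H E D Y Z U)
    (hlam : 0 ≤ lam) (hδ₂ : 0 < δ₂) (hb : BoundedIterates L E M m)
    (hd : DenominatorsBoundedBelow H D δ₁ δ₂) : Bornology.IsBounded (Set.range U) :=
  isBounded_range_of_norm_succ_le fun k => by
    rw [h.U_succ hlam, norm_neg]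
    exact norm_smul_inv_cube_smul_le hδ₂ (apply_nonneg _ _) (weightedL1Seminorm_le hlam hb _)
      (hd.D_le _)

/-- Optimality of `E (k + 1)` places `-Z (k + 1)`, up to bounded terms, in the bounded
subdifferential of the scaled `ℓ₁` norm. -/
theorem IsADMMSequence.isBounded_Z (h : IsADMMSequence X lam μ₁ μ₂ μ₃ L H E D Y Z U)
    (hlam : 0 ≤ lam) (hμ₃ : 0 ≤ μ₃) (hδ₂ : 0 < δ₂) (hd : DenominatorsBoundedBelow H D δ₁ δ₂)
    (hE : Bornology.IsBounded (Set.range E)) (hD : Bornology.IsBounded (Set.range D))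
    (hU : Bornology.IsBounded (Set.range U)) : Bornology.IsBounded (Set.range Z) := by
  obtain ⟨BE, hBE⟩ := exists_norm_le_of_isBounded_range hE
  obtain ⟨BD, hBD⟩ := exists_norm_le_of_isBounded_range hD
  obtain ⟨BU, hBU⟩ := exists_norm_le_of_isBounded_range hU
  obtain ⟨C, hC0, hC⟩ := exists_seminorm_le_mul_norm (weightedL1Seminorm n₁ n₂ n₃ hlam)
  refine isBounded_range_of_norm_succ_le (B := C / δ₂ + (BU + μ₃ * (BE + BD))) fun k => ?_
  have h1 := norm_le_of_seminorm_variational hC0.le hC hδ₂ (hd.D_le k) (h.E_variational hlam k)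
  have e : Z (k + 1) = (U k + μ₃ • (E (k + 1) - D k) + Z (k + 1))
      - (U k + μ₃ • (E (k + 1) - D k)) := (add_sub_cancel_left _ _).symm
  rw [e]
  refine (norm_sub_le _ _).trans (add_le_add h1 ((norm_add_le _ _).trans
    (add_le_add (hBU _) ?_)))
  rw [norm_smul, Real.norm_of_nonneg hμ₃]
  gcongr
  exact (norm_sub_le _ _).trans (add_le_add (hBE _) (hBD _))

theorem norm_mkState_sq (L H E D Y Z U : Tensor n₁ n₂ n₃) : ‖mkState L H E D Y Z U‖ ^ 2 =
    ‖L‖ ^ 2 + ‖H‖ ^ 2 + ‖E‖ ^ 2 + ‖D‖ ^ 2 + ‖Y‖ ^ 2 + ‖Z‖ ^ 2 + ‖U‖ ^ 2 := by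
  rw [PiLp.norm_sq_eq_of_L2]
  simp [mkState, Fin.sum_univ_succ]
  ring

theorem isBounded_range_mkState (hL : Bornology.IsBounded (Set.range L))
    (hH : Bornology.IsBounded (Set.range H)) (hE : Bornology.IsBounded (Set.range E))
    (hD : Bornology.IsBounded (Set.range D)) (hY : Bornology.IsBounded (Set.range Y))
    (hZ : Bornology.IsBounded (Set.range Z)) (hU : Bornology.IsBounded (Set.range U)) :
    Bornology.IsBounded (Set.range fun k =>
      mkState (L k) (H k) (E k) (D k) (Y k) (Z k) (U k)) := by
  obtain ⟨B1, h1⟩ := exists_norm_le_of_isBounded_range hL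
  obtain ⟨B2, h2⟩ := exists_norm_le_of_isBounded_range hH
  obtain ⟨B3, h3⟩ := exists_norm_le_of_isBounded_range hE
  obtain ⟨B4, h4⟩ := exists_norm_le_of_isBounded_range hD
  obtain ⟨B5, h5⟩ := exists_norm_le_of_isBounded_range hY
  obtain ⟨B6, h6⟩ := exists_norm_le_of_isBounded_range hZ
  obtain ⟨B7, h7⟩ := exists_norm_le_of_isBounded_range hU
  refine isBounded_iff_forall_norm_le.2
    ⟨√(B1 ^ 2 + B2 ^ 2 + B3 ^ 2 + B4 ^ 2 + B5 ^ 2 + B6 ^ 2 + B7 ^ 2), ?_⟩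
  rintro _ ⟨k, rfl⟩
  refine Real.le_sqrt_of_sq_le ?_
  rw [norm_mkState_sq]
  gcongr
  exacts [h1 k, h2 k, h3 k, h4 k, h5 k, h6 k, h7 k]

/-! ### Decrease of the Lagrangian along the iteration -/

/-- Effect of a multiplier update on a penalty term. -/
theorem inner_multiplier_update {V : Type*} [NormedAddCommGroup V] [InnerProductSpace ℝ V] {μ : ℝ}
    (hμ : 0 < μ) {y y' r : V} (h : y' = y + μ • r) :
    inner ℝ y' r = inner ℝ y r + ‖y' - y‖ ^ 2 / μ := by
  rw [h, add_sub_cancel_left, inner_add_left, real_inner_smul_left, norm_smul,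
    real_inner_self_eq_norm_sq, Real.norm_of_nonneg hμ.le]
  field_simp

/-- The penalty parameter beyond which a block with numerator bound `a`, Lipschitz constant `C` of
the numerator and denominator bound `δ` decreases sufficiently. -/
def blockThreshold (C a δ : ℝ) : ℝ :=
  1 + 4 * (C / δ ^ 2) ^ 2 + 4 * (a * (4 / δ ^ 3)) ^ 2 + 2 * (a / (2 * δ ^ 3))

/-- A numerator–denominator block decreases by half the squared primal steps, after the increase
from its multiplier update. -/
theorem half_sq_le_block_decrease {V : Type*} [NormedAddCommGroup V] [InnerProductSpace ℝ V]
    {p : Seminorm ℝ V} {C a δ μ : ℝ} (hC : ∀ x, p x ≤ C * ‖x‖) (hδ : 0 < δ)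
    (hμ : blockThreshold C a δ ≤ μ) {L L' H H' Y Y' : V} (hL : p L ≤ a) (hL' : p L' ≤ a)
    (hH : δ ≤ ‖H‖) (hH' : δ ≤ ‖H'‖) (hY : Y = -(p L • (1 / ‖H‖ ^ 3) • H))
    (hY' : Y' = -(p L' • (1 / ‖H'‖ ^ 3) • H')) :
    1 / 2 * (‖L' - L‖ ^ 2 + ‖H' - H‖ ^ 2) ≤ μ / 2 * ‖L' - L‖ ^ 2
      + (μ / 2 - p L' / (2 * ‖H'‖ ^ 3)) * ‖H' - H‖ ^ 2 - ‖Y' - Y‖ ^ 2 / μ := by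
  have ha : 0 ≤ a := (apply_nonneg p L).trans hL
  have hd : ‖Y' - Y‖ ≤ C / δ ^ 2 * ‖L' - L‖ + a * (4 / δ ^ 3) * ‖H' - H‖ := by
    rw [hY, hY', neg_sub_neg, norm_sub_rev]
    refine (norm_smul_inv_cube_smul_sub_le hδ (apply_nonneg p L) hL hH' hH).trans ?_
    gcongr
    rw [div_mul_eq_mul_div]
    gcongr
    exact abs_seminorm_sub_le hC L' L
  have h1 := half_sq_le_decrease_sub_dual (by positivity) hμ (norm_nonneg _) hd
  have h2 : p L' / (2 * ‖H'‖ ^ 3) ≤ a / (2 * δ ^ 3) := by gcongr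
  nlinarith [mul_nonneg (sub_nonneg.2 h2) (sq_nonneg ‖H' - H‖)]

/-- The Lagrangian decreases by half the squared primal steps, up to the increase caused by the
update of `Z`. The formulas for `Y k` and `U k` hold from the first iteration on. -/
theorem IsADMMSequence.decrease (h : IsADMMSequence X lam μ₁ μ₂ μ₃ L H E D Y Z U)
    (hlam : 0 ≤ lam) (hμ₁ : 0 < μ₁) (hμ₂ : 0 < μ₂) (hμ₃ : 0 < μ₃) (hδ₁ : 0 < δ₁) (hδ₂ : 0 < δ₂)
    (hb : BoundedIterates L E M m) (hd : DenominatorsBoundedBelow H D δ₁ δ₂) {C₁ C₂ : ℝ}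
    (hC₁ : ∀ x, nuclearSeminorm n₁ n₂ n₃ x ≤ C₁ * ‖x‖)
    (hC₂ : ∀ x, weightedL1Seminorm n₁ n₂ n₃ hlam x ≤ C₂ * ‖x‖)
    (ht₁ : blockThreshold C₁ M δ₁ ≤ μ₁) (ht₂ : blockThreshold C₂ (lam * m) δ₂ ≤ μ₃)
    {k : ℕ} (hk : 1 ≤ k) :
    augLagrangian X lam μ₁ μ₂ μ₃ (L (k + 1)) (H (k + 1)) (E (k + 1)) (D (k + 1)) (Y (k + 1))
        (Z (k + 1)) (U (k + 1))
      + 1 / 2 * (‖L (k + 1) - L k‖ ^ 2 + ‖H (k + 1) - H k‖ ^ 2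
        + (‖E (k + 1) - E k‖ ^ 2 + ‖D (k + 1) - D k‖ ^ 2)) ≤
      augLagrangian X lam μ₁ μ₂ μ₃ (L k) (H k) (E k) (D k) (Y k) (Z k) (U k)
        + ‖Z (k + 1) - Z k‖ ^ 2 / μ₂ := by
  have hH0 : H k ≠ 0 := norm_pos_iff.1 (hδ₁.trans_le (hd.H_le k))
  have hD0 : D k ≠ 0 := norm_pos_iff.1 (hδ₂.trans_le (hd.D_le k))
  have hL := seminorm_step_decrease _ (norm_nonneg _) (h.L_min hlam k) (L k)
  have hE := seminorm_step_decrease _ (norm_nonneg _) (h.E_min hlam k) (E k)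
  have hH := one_div_norm_step_decrease (apply_nonneg _ _) (h.H_update k).1 (h.H_min hlam k) hH0
  have hD := one_div_norm_step_decrease (apply_nonneg _ _) (h.D_update k).1 (h.D_min hlam k) hD0
  obtain ⟨j, rfl⟩ : ∃ j, k = j + 1 := ⟨k - 1, by omega⟩
  have h1 := half_sq_le_block_decrease hC₁ hδ₁ ht₁ (hb.nuclearNorm_le (j + 1))
    (hb.nuclearNorm_le (j + 1 + 1)) (hd.H_le _) (hd.H_le _) (h.Y_succ hlam j)
    (h.Y_succ hlam (j + 1))
  have h2 := half_sq_le_block_decrease hC₂ hδ₂ ht₂ (weightedL1Seminorm_le hlam hb (j + 1))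
    (weightedL1Seminorm_le hlam hb (j + 1 + 1)) (hd.D_le _) (hd.D_le _) (h.U_succ hlam j)
    (h.U_succ hlam (j + 1))
  have hY := inner_multiplier_update hμ₁ (h.Y_update (j + 1))
  have hZ := inner_multiplier_update hμ₂ (h.Z_update (j + 1))
  have hU := inner_multiplier_update hμ₃ (h.U_update (j + 1))
  simp only [← sub_add, sub_add_eq_add_sub] at hL hE
  rw [add_comm (E (j + 1 + 1)) (L (j + 1 + 1)), add_comm (E (j + 1)) (L (j + 1 + 1))] at hE
  rw [augLagrangian_eq_blocks hlam, augLagrangian_eq_blocks hlam, hY, hZ, hU]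
  have hL0 : 0 ≤ μ₂ / 2 * ‖L (j + 1 + 1) - L (j + 1)‖ ^ 2 := by positivity
  have hE0 : 0 ≤ μ₂ / 2 * ‖E (j + 1 + 1) - E (j + 1)‖ ^ 2 := by positivity
  linarith

theorem neg_sq_div_le_penalty {V : Type*} [NormedAddCommGroup V] [InnerProductSpace ℝ V] {μ B : ℝ}
    (hμ : 0 < μ) {y : V} (hy : ‖y‖ ≤ B) (r : V) :
    -(B ^ 2 / (2 * μ)) ≤ μ / 2 * ‖r‖ ^ 2 + inner ℝ y r := by
  have h1 := neg_le_of_abs_le (abs_real_inner_le_norm y r)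
  have h2 : ‖y‖ * ‖r‖ ≤ B * ‖r‖ := by gcongr
  have h3 : 0 ≤ (μ * ‖r‖ - B) ^ 2 / (2 * μ) := by positivity
  have e : (μ * ‖r‖ - B) ^ 2 / (2 * μ) = μ / 2 * ‖r‖ ^ 2 - B * ‖r‖ + B ^ 2 / (2 * μ) := by
    field_simp
    ring
  linarith

theorem exists_le_augLagrangian (hlam : 0 ≤ lam) (hμ₁ : 0 < μ₁) (hμ₂ : 0 < μ₂) (hμ₃ : 0 < μ₃)
    (hY : Bornology.IsBounded (Set.range Y)) (hZ : Bornology.IsBounded (Set.range Z))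
    (hU : Bornology.IsBounded (Set.range U)) :
    ∃ B, ∀ k, B ≤ augLagrangian X lam μ₁ μ₂ μ₃ (L k) (H k) (E k) (D k) (Y k) (Z k) (U k) := by
  obtain ⟨BY, hBY⟩ := exists_norm_le_of_isBounded_range hY
  obtain ⟨BZ, hBZ⟩ := exists_norm_le_of_isBounded_range hZ
  obtain ⟨BU, hBU⟩ := exists_norm_le_of_isBounded_range hU
  refine ⟨-(BY ^ 2 / (2 * μ₁)) + -(BU ^ 2 / (2 * μ₃)) + -(BZ ^ 2 / (2 * μ₂)), fun k => ?_⟩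
  rw [augLagrangian_eq_blocks hlam]
  have h1 := neg_sq_div_le_penalty hμ₁ (hBY k) (L k - H k)
  have h2 := neg_sq_div_le_penalty hμ₂ (hBZ k) (L k + E k - X)
  have h3 := neg_sq_div_le_penalty hμ₃ (hBU k) (E k - D k)
  have h4 : 0 ≤ nuclearSeminorm n₁ n₂ n₃ (L k) / ‖H k‖ :=
    div_nonneg (apply_nonneg _ _) (norm_nonneg _)
  have h5 : 0 ≤ weightedL1Seminorm n₁ n₂ n₃ hlam (E k) / ‖D k‖ :=
    div_nonneg (apply_nonneg _ _) (norm_nonneg _)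
  linarith

/-! ### Critical points -/

theorem frechetSubdifferential_subset_limitingSubdifferential {V : Type*} [NormedAddCommGroup V]
    [InnerProductSpace ℝ V] (f : V → ℝ) (s : Set V) (x : V) :
    frechetSubdifferential f s x ⊆ limitingSubdifferential f s x := fun v hv =>
  ⟨hv.1, fun _ => x, fun _ => v, fun _ => hv, tendsto_const_nhds, tendsto_const_nhds,
    tendsto_const_nhds⟩

/-- A feasible state satisfying the blockwise first-order conditions is critical. The first-order
terms of the block lower bounds cancel, so that zero is even a Fréchet subgradient. -/
theorem isCriticalPoint_of_blockwise (hlam : 0 ≤ lam) (hμ₁ : 0 ≤ μ₁) (hμ₂ : 0 ≤ μ₂) (hμ₃ : 0 ≤ μ₃)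
    {C : State n₁ n₂ n₃} (h01 : C 1 = C 0) (h23 : C 3 = C 2) (hX : C 0 + C 2 = X)
    (hL : C 0 ≠ 0) (hE : C 2 ≠ 0)
    (hY : C 4 = -(nuclearSeminorm n₁ n₂ n₃ (C 0) • (1 / ‖C 0‖ ^ 3) • C 0))
    (hU : C 6 = -(weightedL1Seminorm n₁ n₂ n₃ hlam (C 2) • (1 / ‖C 2‖ ^ 3) • C 2))
    (hvL : ∀ T, nuclearSeminorm n₁ n₂ n₃ (C 0) / ‖C 0‖ ≤
      nuclearSeminorm n₁ n₂ n₃ T / ‖C 0‖ + inner ℝ (C 4 + C 5) (T - C 0))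
    (hvE : ∀ T, weightedL1Seminorm n₁ n₂ n₃ hlam (C 2) / ‖C 2‖ ≤
      weightedL1Seminorm n₁ n₂ n₃ hlam T / ‖C 2‖ + inner ℝ (C 6 + C 5) (T - C 2)) :
    IsCriticalPoint X lam μ₁ μ₂ μ₃ C := by
  apply frechetSubdifferential_subset_limitingSubdifferential
  refine ⟨⟨by rwa [h01], by rwa [h23]⟩, fun ε hε => ?_⟩
  obtain ⟨K₁, hK₁, hb₁⟩ := exists_block_lower_bound _ hμ₁ hL hY hvL
  obtain ⟨K₂, hK₂, hb₂⟩ := exists_block_lower_bound _ hμ₃ hE hU hvE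
  have hK : 0 < K₁ + K₂ + 2 := by linarith
  have hρ : 0 < min 1 (ε / (K₁ + K₂ + 2)) := lt_min one_pos (div_pos hε hK)
  filter_upwards [self_mem_nhdsWithin,
    mem_nhdsWithin_of_mem_nhds (Metric.ball_mem_nhds C hρ)] with y hy hyb
  rw [Metric.mem_ball, dist_eq_norm] at hyb
  set r := ‖y - C‖ with hr
  have hr0 : 0 ≤ r := norm_nonneg _
  have hr1 : r ≤ 1 := hyb.le.trans (min_le_left _ _)
  have hr2 : (K₁ + K₂ + 2) * r ≤ ε := by
    have := hyb.le.trans (min_le_right _ _)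
    rwa [le_div_iff₀ hK, mul_comm] at this
  have hc : ∀ i, ‖y i - C i‖ ≤ r := fun i => by
    rw [← PiLp.sub_apply]
    exact PiLp.norm_apply_le (y - C) i
  have e1 := hb₁ r (y 0) (y 1) (y 4) hr1 hy.1 (hc 0) (h01 ▸ hc 1) (hc 4)
  have e2 := hb₂ r (y 2) (y 3) (y 6) hr1 hy.2 (hc 2) (h23 ▸ hc 3) (hc 6)
  have hres : y 0 + y 2 - X = (y 0 - C 0) + (y 2 - C 2) := by
    rw [← hX]
    abel
  have e3 : -(2 * r ^ 2) ≤ inner ℝ (y 5 - C 5) (y 0 + y 2 - X) := by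
    have h7 : ‖y 0 + y 2 - X‖ ≤ 2 * r := by
      rw [hres]
      exact (norm_add_le _ _).trans (by linarith [hc 0, hc 2])
    have h8 : |inner ℝ (y 5 - C 5) (y 0 + y 2 - X)| ≤ r * (2 * r) :=
      (abs_real_inner_le_norm _ _).trans (mul_le_mul (hc 5) h7 (norm_nonneg _) hr0)
    nlinarith [neg_le_of_abs_le h8]
  have e4 : inner ℝ (y 5) (y 0 + y 2 - X) = inner ℝ (y 5 - C 5) (y 0 + y 2 - X)
      + (inner ℝ (C 5) (y 0 - C 0) + inner ℝ (C 5) (y 2 - C 2)) := by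
    rw [← inner_add_right, ← hres, inner_sub_left, sub_add_cancel]
  have e5 : 0 ≤ μ₂ / 2 * ‖y 0 + y 2 - X‖ ^ 2 := by positivity
  have e6 : stateLagrangian X lam μ₁ μ₂ μ₃ C = nuclearSeminorm n₁ n₂ n₃ (C 0) / ‖C 0‖
      + weightedL1Seminorm n₁ n₂ n₃ hlam (C 2) / ‖C 2‖ := by
    rw [stateLagrangian, augLagrangian_eq_blocks hlam, h01, h23, hX]
    simp
  have e7 : (K₁ + K₂ + 2) * r * r ≤ ε * r := mul_le_mul_of_nonneg_right hr2 hr0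
  rw [e6, stateLagrangian, augLagrangian_eq_blocks hlam, e4, inner_zero_left]
  nlinarith

/-- A limit of iterates along which the primal steps and the step in `Z` tend to zero is
critical: the optimality conditions of the four minimization steps pass to the limit. -/
theorem IsADMMSequence.isCriticalPoint_of_tendsto
    (h : IsADMMSequence X lam μ₁ μ₂ μ₃ L H E D Y Z U)
    (hlam : 0 ≤ lam) (hμ₁ : 0 < μ₁) (hμ₂ : 0 < μ₂) (hμ₃ : 0 < μ₃) (hδ₁ : 0 < δ₁) (hδ₂ : 0 < δ₂)
    (hd : DenominatorsBoundedBelow H D δ₁ δ₂) {φ : ℕ → ℕ} (hφ : Tendsto φ atTop atTop)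
    {C : State n₁ n₂ n₃}
    (hC : Tendsto (fun i => mkState (L (φ i)) (H (φ i)) (E (φ i)) (D (φ i)) (Y (φ i)) (Z (φ i))
      (U (φ i))) atTop (𝓝 C))
    (hL : Tendsto (fun i => L (φ i + 1) - L (φ i)) atTop (𝓝 0))
    (hH : Tendsto (fun i => H (φ i + 1) - H (φ i)) atTop (𝓝 0))
    (hE : Tendsto (fun i => E (φ i + 1) - E (φ i)) atTop (𝓝 0))
    (hD : Tendsto (fun i => D (φ i + 1) - D (φ i)) atTop (𝓝 0))
    (hZ : Tendsto (fun i => Z (φ i + 1) - Z (φ i)) atTop (𝓝 0)) :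
    IsCriticalPoint X lam μ₁ μ₂ μ₃ C := by
  have hpr : ∀ j, Tendsto (fun i => mkState (L (φ i)) (H (φ i)) (E (φ i)) (D (φ i)) (Y (φ i))
      (Z (φ i)) (U (φ i)) j) atTop (𝓝 (C j)) := fun j =>
    ((PiLp.continuous_apply 2 _ j).tendsto C).comp hC
  have hL0 : Tendsto (fun i => L (φ i)) atTop (𝓝 (C 0)) := hpr 0
  have hH0 : Tendsto (fun i => H (φ i)) atTop (𝓝 (C 1)) := hpr 1
  have hE0 : Tendsto (fun i => E (φ i)) atTop (𝓝 (C 2)) := hpr 2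
  have hD0 : Tendsto (fun i => D (φ i)) atTop (𝓝 (C 3)) := hpr 3
  have hY0 : Tendsto (fun i => Y (φ i)) atTop (𝓝 (C 4)) := hpr 4
  have hZ0 : Tendsto (fun i => Z (φ i)) atTop (𝓝 (C 5)) := hpr 5
  have hU0 : Tendsto (fun i => U (φ i)) atTop (𝓝 (C 6)) := hpr 6
  have hnext : ∀ {x : ℕ → Tensor n₁ n₂ n₃} {c : Tensor n₁ n₂ n₃},
      Tendsto (fun i => x (φ i + 1) - x (φ i)) atTop (𝓝 0) →
      Tendsto (fun i => x (φ i)) atTop (𝓝 c) → Tendsto (fun i => x (φ i + 1)) atTop (𝓝 c) := by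
    intro x c h1 h2
    simpa using h1.add h2
  have hL1 := hnext hL hL0
  have hH1 := hnext hH hH0
  have hE1 := hnext hE hE0
  have hD1 := hnext hD hD0
  have hZ1 := hnext hZ hZ0
  have hcont : ∀ p : Seminorm ℝ (Tensor n₁ n₂ n₃), Continuous p := fun p =>
    p.convexOn.locallyLipschitz.continuous
  have hp := hcont (nuclearSeminorm n₁ n₂ n₃)
  have hq := hcont (weightedL1Seminorm n₁ n₂ n₃ hlam)
  have hC1 : 0 < ‖C 1‖ := hδ₁.trans_le (ge_of_tendsto' hH0.norm fun i => hd.H_le _)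
  have hC3 : 0 < ‖C 3‖ := hδ₂.trans_le (ge_of_tendsto' hD0.norm fun i => hd.D_le _)
  have hmult : ∀ {p : Seminorm ℝ (Tensor n₁ n₂ n₃)}, Continuous p →
      ∀ {x y : ℕ → Tensor n₁ n₂ n₃} {a b : Tensor n₁ n₂ n₃}, 0 < ‖b‖ → Tendsto x atTop (𝓝 a) →
      Tendsto y atTop (𝓝 b) → Tendsto (fun i => -(p (x i) • (1 / ‖y i‖ ^ 3) • y i)) atTop
        (𝓝 (-(p a • (1 / ‖b‖ ^ 3) • b))) := by
    intro p hp x y a b hb hx hy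
    exact (((hp.tendsto a).comp hx).smul
      ((tendsto_const_nhds.div (hy.norm.pow 3) (pow_ne_zero 3 hb.ne')).smul hy)).neg
  -- the multipliers converge to their stationary values, and so do their shifts
  have hY1 := hmult hp hC1 hL1 hH1
  have hU1 := hmult hq hC3 hE1 hD1
  simp only [← h.Y_succ hlam] at hY1
  simp only [← h.U_succ hlam] at hU1
  have hpos : ∀ᶠ i in atTop, 1 ≤ φ i := hφ.eventually_ge_atTop 1
  have hYC : C 4 = -(nuclearSeminorm n₁ n₂ n₃ (C 0) • (1 / ‖C 1‖ ^ 3) • C 1) := by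
    refine tendsto_nhds_unique hY0 ((hmult hp hC1 hL0 hH0).congr' ?_)
    filter_upwards [hpos] with i hi
    obtain ⟨j, hj⟩ : ∃ j, φ i = j + 1 := ⟨φ i - 1, by omega⟩
    rw [hj, h.Y_succ hlam]
  have hUC : C 6 = -(weightedL1Seminorm n₁ n₂ n₃ hlam (C 2) • (1 / ‖C 3‖ ^ 3) • C 3) := by
    refine tendsto_nhds_unique hU0 ((hmult hq hC3 hE0 hD0).congr' ?_)
    filter_upwards [hpos] with i hi
    obtain ⟨j, hj⟩ : ∃ j, φ i = j + 1 := ⟨φ i - 1, by omega⟩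
    rw [hj, h.U_succ hlam]
  rw [← hYC] at hY1
  rw [← hUC] at hU1
  have hres : ∀ {μ : ℝ} {y r : ℕ → Tensor n₁ n₂ n₃} {c s : Tensor n₁ n₂ n₃}, 0 < μ →
      (∀ k, y (k + 1) = y k + μ • r (k + 1)) → Tendsto (fun i => y (φ i)) atTop (𝓝 c) →
      Tendsto (fun i => y (φ i + 1)) atTop (𝓝 c) → Tendsto (fun i => r (φ i + 1)) atTop (𝓝 s) →
      s = 0 := by
    intro μ y r c s hμ hupd h0 h1 hs
    have h2 : c = c + μ • s :=
      tendsto_nhds_unique h1 ((h0.add (hs.const_smul μ)).congr fun i => (hupd _).symm)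
    exact (smul_eq_zero.1 (left_eq_add.1 h2)).resolve_left hμ.ne'
  have h01 : C 0 - C 1 = 0 := hres (r := fun k => L k - H k) hμ₁ h.Y_update hY0 hY1 (hL1.sub hH1)
  have h23 : C 2 - C 3 = 0 := hres (r := fun k => E k - D k) hμ₃ h.U_update hU0 hU1 (hE1.sub hD1)
  have hX : C 0 + C 2 - X = 0 := hres (r := fun k => L k + E k - X) hμ₂ h.Z_update hZ0 hZ1
    ((hL1.add hE1).sub tendsto_const_nhds)
  have h10 : C 1 = C 0 := (sub_eq_zero.1 h01).symm
  have h32 : C 3 = C 2 := (sub_eq_zero.1 h23).symm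
  refine isCriticalPoint_of_blockwise hlam hμ₁.le hμ₂.le hμ₃.le h10 h32 (sub_eq_zero.1 hX)
    (norm_pos_iff.1 (h10 ▸ hC1)) (norm_pos_iff.1 (h32 ▸ hC3)) (by rw [hYC, h10])
    (by rw [hUC, h32]) (fun T => ?_) fun T => ?_
  · have hl := le_of_tendsto_of_tendsto' (((hp.tendsto _).comp hL1).div hH0.norm hC1.ne')
      (((tendsto_const_nhds (x := nuclearSeminorm n₁ n₂ n₃ T)).div hH0.norm hC1.ne').add
        (((hY0.add ((hL1.sub hH0).const_smul μ₁)).add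
          (hZ0.add ((hL1.sub (tendsto_const_nhds.sub hE0)).const_smul μ₂))).inner
            (tendsto_const_nhds.sub hL1)))
      fun i => h.L_variational hlam (φ i) T
    have hX' : C 0 - (X - C 2) = 0 := by rw [← hX]; abel
    rwa [h01, hX', h10, smul_zero, smul_zero, add_zero, add_zero] at hl
  · have hl := le_of_tendsto_of_tendsto' (((hq.tendsto _).comp hE1).div hD0.norm hC3.ne')
      (((tendsto_const_nhds (x := weightedL1Seminorm n₁ n₂ n₃ hlam T)).div hD0.norm hC3.ne').add
        (((hU0.add ((hE1.sub hD0).const_smul μ₃)).add hZ1).inner (tendsto_const_nhds.sub hE1)))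
      fun i => h.E_variational hlam (φ i) T
    rwa [h23, h32, smul_zero, add_zero] at hl

/-- For large `μ₁` and `μ₃` and vanishing `Z`-steps, all primal steps vanish along a
subsequence. The `Z`-steps need not be square summable, so the decrease does not yield this for the
whole sequence. -/
theorem IsADMMSequence.exists_subseq_steps_tendsto_zero
    (h : IsADMMSequence X lam μ₁ μ₂ μ₃ L H E D Y Z U)
    (hlam : 0 ≤ lam) (hμ₁ : 0 < μ₁) (hμ₂ : 0 < μ₂) (hμ₃ : 0 < μ₃) (hδ₁ : 0 < δ₁) (hδ₂ : 0 < δ₂)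
    (hb : BoundedIterates L E M m) (hd : DenominatorsBoundedBelow H D δ₁ δ₂) {C₁ C₂ : ℝ}
    (hC₁ : ∀ x, nuclearSeminorm n₁ n₂ n₃ x ≤ C₁ * ‖x‖)
    (hC₂ : ∀ x, weightedL1Seminorm n₁ n₂ n₃ hlam x ≤ C₂ * ‖x‖)
    (ht₁ : blockThreshold C₁ M δ₁ ≤ μ₁) (ht₂ : blockThreshold C₂ (lam * m) δ₂ ≤ μ₃)
    (hYb : Bornology.IsBounded (Set.range Y)) (hZb : Bornology.IsBounded (Set.range Z))
    (hUb : Bornology.IsBounded (Set.range U))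
    (hZ : Tendsto (fun k => ‖Z (k + 1) - Z k‖) atTop (𝓝 0)) :
    ∃ φ : ℕ → ℕ, StrictMono φ ∧
      Tendsto (fun i => L (φ i + 1) - L (φ i)) atTop (𝓝 0) ∧
      Tendsto (fun i => H (φ i + 1) - H (φ i)) atTop (𝓝 0) ∧
      Tendsto (fun i => E (φ i + 1) - E (φ i)) atTop (𝓝 0) ∧
      Tendsto (fun i => D (φ i + 1) - D (φ i)) atTop (𝓝 0) := by
  obtain ⟨B, hB⟩ := exists_le_augLagrangian (X := X) (L := L) (H := H) (E := E) (D := D) hlam hμ₁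
    hμ₂ hμ₃ hYb hZb hUb
  have hz : Tendsto (fun k => ‖Z (k + 1) - Z k‖ ^ 2 / μ₂) atTop (𝓝 0) := by
    simpa using (hZ.pow 2).div_const μ₂
  obtain ⟨φ, hφ, hs⟩ := exists_subseq_tendsto_zero_of_decrease
    (s := fun k => 1 / 2 * (‖L (k + 1) - L k‖ ^ 2 + ‖H (k + 1) - H k‖ ^ 2
        + (‖E (k + 1) - E k‖ ^ 2 + ‖D (k + 1) - D k‖ ^ 2)))
    hB (fun k => by positivity) hz
    ((eventually_ge_atTop 1).mono fun k hk =>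
      h.decrease hlam hμ₁ hμ₂ hμ₃ hδ₁ hδ₂ hb hd hC₁ hC₂ ht₁ ht₂ hk)
  have hs2 := hs.const_mul 2
  rw [mul_zero] at hs2
  have key : ∀ x : ℕ → Tensor n₁ n₂ n₃,
      (∀ k, ‖x k‖ ^ 2 ≤ 2 * (1 / 2 * (‖L (k + 1) - L k‖ ^ 2 + ‖H (k + 1) - H k‖ ^ 2
        + (‖E (k + 1) - E k‖ ^ 2 + ‖D (k + 1) - D k‖ ^ 2)))) →
      Tendsto (fun i => x (φ i)) atTop (𝓝 0) := by
    intro x hx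
    rw [tendsto_zero_iff_norm_tendsto_zero]
    have h1 := squeeze_zero (fun i => sq_nonneg ‖x (φ i)‖) (fun i => hx (φ i)) hs2
    simpa using h1.sqrt
  refine ⟨φ, hφ, key (fun k => L (k + 1) - L k) fun k => ?_,
    key (fun k => H (k + 1) - H k) fun k => ?_, key (fun k => E (k + 1) - E k) fun k => ?_,
    key (fun k => D (k + 1) - D k) fun k => ?_⟩ <;>
  nlinarith [sq_nonneg ‖L (k + 1) - L k‖, sq_nonneg ‖H (k + 1) - H k‖,
    sq_nonneg ‖E (k + 1) - E k‖, sq_nonneg ‖D (k + 1) - D k‖]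

end ADMM

end TNFPlus

end

theorem theorem3 (n₁ n₂ n₃ : ℕ) (lam M m δ₁ δ₂ : ℝ)
    (hlam : 0 < lam) (hδ₁ : 0 < δ₁) (hδ₂ : 0 < δ₂) :
    ∃ μbar : ℝ, ∀ (X : TNFPlus.Tensor n₁ n₂ n₃) (μ₁ μ₂ μ₃ : ℝ), 0 < μ₁ → 0 < μ₂ → 0 < μ₃ →
      ∀ L H E D Y Z U : ℕ → TNFPlus.Tensor n₁ n₂ n₃,
        TNFPlus.IsADMMSequence X lam μ₁ μ₂ μ₃ L H E D Y Z U →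
        TNFPlus.BoundedIterates L E M m →
        TNFPlus.DenominatorsBoundedBelow H D δ₁ δ₂ →
        (Bornology.IsBounded (Set.range L) ∧ Bornology.IsBounded (Set.range H) ∧
          Bornology.IsBounded (Set.range E) ∧ Bornology.IsBounded (Set.range D) ∧
          Bornology.IsBounded (Set.range Y) ∧ Bornology.IsBounded (Set.range Z) ∧
          Bornology.IsBounded (Set.range U)) ∧
        ∃ (φ : ℕ → ℕ) (Cstar : TNFPlus.State n₁ n₂ n₃), StrictMono φ ∧
          Filter.Tendsto
            (fun i => TNFPlus.mkState (L (φ i)) (H (φ i)) (E (φ i)) (D (φ i))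
              (Y (φ i)) (Z (φ i)) (U (φ i)))
            Filter.atTop (nhds Cstar) ∧
          (μbar ≤ μ₁ → μbar ≤ μ₃ →
            Filter.Tendsto (fun k => ‖Z (k + 1) - Z k‖) Filter.atTop (nhds 0) →
            TNFPlus.IsCriticalPoint X lam μ₁ μ₂ μ₃ Cstar) := by
  obtain ⟨C₁, -, hC₁⟩ := TNFPlus.exists_seminorm_le_mul_norm (TNFPlus.nuclearSeminorm n₁ n₂ n₃)
  obtain ⟨C₂, -, hC₂⟩ :=
    TNFPlus.exists_seminorm_le_mul_norm (TNFPlus.weightedL1Seminorm n₁ n₂ n₃ hlam.le)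
  refine ⟨max (TNFPlus.blockThreshold C₁ M δ₁) (TNFPlus.blockThreshold C₂ (lam * m) δ₂), ?_⟩
  intro X μ₁ μ₂ μ₃ hμ₁ hμ₂ hμ₃ L H E D Y Z U h hb hd
  have hY := h.isBounded_Y hlam.le hδ₁ hb hd
  have hU := h.isBounded_U hlam.le hδ₂ hb hd
  have hH := TNFPlus.isBounded_range_of_multiplier_update hμ₁ hb.L_bounded hY h.Y_update
  have hD := TNFPlus.isBounded_range_of_multiplier_update hμ₃ hb.E_bounded hU h.U_update
  have hZ := h.isBounded_Z hlam.le hμ₃.le hδ₂ hd hb.E_bounded hD hU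
  have hS := TNFPlus.isBounded_range_mkState hb.L_bounded hH hb.E_bounded hD hY hZ hU
  refine ⟨⟨hb.L_bounded, hH, hb.E_bounded, hD, hY, hZ, hU⟩, ?_⟩
  by_cases hlarge :
      max (TNFPlus.blockThreshold C₁ M δ₁) (TNFPlus.blockThreshold C₂ (lam * m) δ₂) ≤ μ₁ ∧
      max (TNFPlus.blockThreshold C₁ M δ₁) (TNFPlus.blockThreshold C₂ (lam * m) δ₂) ≤ μ₃ ∧
      Filter.Tendsto (fun k => ‖Z (k + 1) - Z k‖) Filter.atTop (nhds 0)
  · obtain ⟨ht₁, ht₂, hZ0⟩ := hlarge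
    -- a first subsequence makes the steps vanish, a further one makes the iterates converge
    obtain ⟨φ, hφ, sL, sH, sE, sD⟩ := h.exists_subseq_steps_tendsto_zero hlam.le hμ₁ hμ₂ hμ₃ hδ₁
      hδ₂ hb hd hC₁ hC₂ ((le_max_left _ _).trans ht₁) ((le_max_right _ _).trans ht₂) hY hZ hU hZ0
    obtain ⟨C, -, ψ, hψ, hC⟩ := tendsto_subseq_of_bounded hS fun i => Set.mem_range_self (φ i)
    have hψ' := hψ.tendsto_atTop
    refine ⟨φ ∘ ψ, C, hφ.comp hψ, hC, fun _ _ _ => ?_⟩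
    exact h.isCriticalPoint_of_tendsto hlam.le hμ₁ hμ₂ hμ₃ hδ₁ hδ₂ hd (hφ.comp hψ).tendsto_atTop hC
      (sL.comp hψ') (sH.comp hψ') (sE.comp hψ') (sD.comp hψ')
      ((tendsto_zero_iff_norm_tendsto_zero.2 hZ0).comp (hφ.comp hψ).tendsto_atTop)
  · obtain ⟨C, -, φ, hφ, hC⟩ := tendsto_subseq_of_bounded hS fun i => Set.mem_range_self i
    exact ⟨φ, C, hφ, hC, fun h1 h2 h3 => absurd ⟨h1, h2, h3⟩ hlarge⟩
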